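/- Let $G$ be a finite simple undirected graph with $n$ vertices and let $s$ be a vertex of $G$ that initially knows a rumour. In the synchronous push&pull protocol, in each round $1,2,\dots$ every vertex $x$ simultaneously calls a uniformly random neighbour $y$, all choices being independent; if exactly one of $x,y$ knew the rumour before the round, then the other one knows it after the round. In the asynchronous push&pull protocol, each vertex has an independent Poisson clock of rate $1$, started at time $0$; whenever the clock of a vertex $x$ rings, $x$ calls a uniformly random neighbour $y$, all choices being independent of each other and of the clocks, and if exactly one of $x,y$ knows the rumour just before the call, then the other one knows it from then on. (A vertex without neighbours makes no calls.) Let $S(G,s)\in\{0,1,2,\dots\}\cup\{\infty\}$ and $A(G,s)\in[0,\infty]$ be the first round, respectively the first time, at which all vertices know the rumour in the synchronous, respectively asynchronous, protocol ($\infty$ if this never happens). Theorem. For every $K>0$ there is a $C>0$ such that, for every finite graph $G$ (with $n\ge 1$ vertices), every start vertex $s$ of $G$ and every real $t\ge 1$, $$\mathbb{P}\big[S(G,s) > C\,(t + t^{2/3} n^{1/3}\log n)\big] \;\le\; \mathbb{P}\big[A(G,s)>t\big] + C n^{-K},$$ where $\log$ is the natural logarithm. -/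

import Mathlib

open MeasureTheory ProbabilityTheory
open scoped NNReal ENNReal

namespace PushPull

noncomputable section

/-- The law of the vertex called by `x`: uniform over the neighbours of `x`. A vertex without
neighbours makes no call, which is encoded by letting it call itself. -/
def callPMF {V : Type*} [Fintype V] (G : SimpleGraph V) (x : V) : PMF V :=
  open Classical in
  if h : (Finset.univ.filter (fun y => G.Adj x y)).Nonempty then
    PMF.uniformOfFinset (Finset.univ.filter (fun y => G.Adj x y)) h
  else PMF.pure x

/-! ### The synchronous protocol -/

/-- A realization of the calls of the synchronous protocol: `c (r, x)` is the vertex that `x`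
calls in round `r + 1`. -/
abbrev SyncCalls (V : Type*) := ℕ × V → V

/-- In every round every vertex calls a uniformly random neighbour, all choices independent. -/
def syncMeasure {V : Type*} [Fintype V] [MeasurableSpace V] (G : SimpleGraph V) :
    Measure (SyncCalls V) :=
  Measure.infinitePi (fun p : ℕ × V => (callPMF G p.2).toMeasure)

/-- The vertices that know the rumour after `r` rounds when it starts at `s`. In a round, the
vertices `v` that learn the rumour are those that are called by a vertex which knew it before the
round (push) and those that call a vertex which knew it before the round (pull). -/
def syncInformed {V : Type*} (c : SyncCalls V) (s : V) : ℕ → Set V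
  | 0 => {s}
  | r + 1 => {v | v ∈ syncInformed c s r ∨
      (∃ x ∈ syncInformed c s r, c (r, x) = v) ∨ c (r, v) ∈ syncInformed c s r}

/-- The synchronous spread time: the first round after which everyone knows the rumour
(`∞` if there is none). -/
def syncSpreadTime {V : Type*} (c : SyncCalls V) (s : V) : ℝ≥0∞ :=
  ⨅ (r : ℕ) (_ : ∀ v, v ∈ syncInformed c s r), (r : ℝ≥0∞)

/-! ### The asynchronous protocol -/

/-- A realization of the clocks and calls of the asynchronous protocol: `(ω (x, k)).1` is the
waiting time between the `k`-th ring (time `0` for `k = 0`) and the `(k + 1)`-st ring of the clock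
of `x`, and `(ω (x, k)).2` is the vertex that `x` calls at its `(k + 1)`-st ring. -/
abbrev AsyncSample (V : Type*) := V × ℕ → ℝ × V

/-- The clocks are independent Poisson processes of rate `1` (independent exponential waiting
times of rate `1`), and at each ring the vertex calls a uniformly random neighbour; all waiting
times and choices are independent. -/
def asyncMeasure {V : Type*} [Fintype V] [MeasurableSpace V] (G : SimpleGraph V) :
    Measure (AsyncSample V) :=
  haveI : IsProbabilityMeasure (expMeasure 1) := isProbabilityMeasure_expMeasure one_pos
  Measure.infinitePi (fun p : V × ℕ => (expMeasure 1).prod (callPMF G p.1).toMeasure)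

/-- The time of the `(k + 1)`-st ring of the clock of `x`. -/
def ringTime {V : Type*} (ω : AsyncSample V) (x : V) (k : ℕ) : ℝ :=
  ∑ i ∈ Finset.range (k + 1), (ω (x, i)).1

/-- The vertex that `x` calls at the `(k + 1)`-st ring of its clock. -/
def callee {V : Type*} (ω : AsyncSample V) (x : V) (k : ℕ) : V := (ω (x, k)).2

/-- `AsyncKnows ω s t v`: in the asynchronous protocol with start vertex `s`, the vertex `v` knows
the rumour at time `t`. -/
inductive AsyncKnows {V : Type*} (ω : AsyncSample V) (s : V) : ℝ → V → Prop
  | start : AsyncKnows ω s 0 s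
  | remember {t t' : ℝ} {v : V} : AsyncKnows ω s t v → t ≤ t' → AsyncKnows ω s t' v
  | push {t : ℝ} {x : V} {k : ℕ} : AsyncKnows ω s t x → t < ringTime ω x k →
      AsyncKnows ω s (ringTime ω x k) (callee ω x k)
  | pull {t : ℝ} {x : V} {k : ℕ} : AsyncKnows ω s t (callee ω x k) → t < ringTime ω x k →
      AsyncKnows ω s (ringTime ω x k) x

/-- The asynchronous spread time: the first time at which everyone knows the rumour
(`∞` if there is none). -/
def asyncSpreadTime {V : Type*} (ω : AsyncSample V) (s : V) : ℝ≥0∞ :=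
  ⨅ (t : ℝ≥0) (_ : ∀ v, AsyncKnows ω s t v), (t : ℝ≥0∞)

end

end PushPull

/-! Cut `[0, 2t]` into `W` windows of length `τ` and make the asynchronous protocol more generous:
inside a window every call may be used in both directions and in any order (`windows`,
`AsyncKnows.mem_windows`). The generous process depends only on which vertex calls which in which
window, that is, on rows that are independent over the vertices (`map_asyncRow`).

Each window is explored in levels. In a level every vertex gets one fresh random call and a coin of
success probability `p = τ`, and the call may be used only if the coin shows `true`. With its coins
ignored, a level is a synchronous round with the same calls, so the synchronous protocol is never
behind the exploration (`explore_I_subset_syncInformed`). One coin and one call per vertex and level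
are enough because of the Mecke formula: a Poisson clock seen from one of its rings is the clock
with an extra ring, at the price of the rate (`lintegral_ring`, `lintegral_clockRow_le`). Hence what
a level reveals is stochastically dominated by a coin, a fresh call and a fresh, unconditioned row
(`MeckeLaw.lintegral_le`, `lintegral_dataBefore_le`), and domination passes to the product over the
vertices (`measure_final_le_step`).

It remains to bound the number of levels. If a window survives many levels, there is a long chain of
transmissions: a vertex stays active, pushes, or is pulled from. Pulls can concentrate on a vertex,
so chains are weighted by `ψ`, a generating function of chains of pulls, and pushes into the set `B`
of vertices of large `ψ` are left out. With this weight the expected number of chains halves in each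
level (`measure_chain_le`), while `B` has at most `144 τ² n` elements (`exists_contracts`). Outside
an event of small probability, every block of `L + 1` levels therefore finishes a window or informs
a vertex of `B` (`potential_explore_lt`), so about `(W + 144 τ² n) L` rounds suffice, with `L` of
order `log n`.

For `t ≤ n`, put `X = t^(2/3) n^(1/3)`. With `W` of order `X` and `τ` of order `t / X`, both `W` and
`τ² n` are `O(X)` (`sync_le_async_of_le`). For `t ≥ n` and `G` connected, `O(n log n)` rounds
suffice with high probability, whatever the asynchronous protocol does (`sync_le_of_connected`). If
`G` is disconnected, the asynchronous spread time is almost surely infinite. -/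

namespace PushPull

/-! ### Product measures: splitting off a term, shifting, stochastic domination. -/

/-- Prepend a term to a sequence. -/
def seqCons {X : Type*} (a : X) (f : ℕ → X) : ℕ → X
  | 0 => a
  | n + 1 => f n

@[simp] lemma seqCons_zero {X : Type*} (a : X) (f : ℕ → X) : seqCons a f 0 = a := rfl

@[simp] lemma seqCons_succ {X : Type*} (a : X) (f : ℕ → X) (n : ℕ) :
    seqCons a f (n + 1) = f n := rfl

lemma measurable_seqCons {X : Type*} [MeasurableSpace X] :
    Measurable (fun p : X × (ℕ → X) => seqCons p.1 p.2) := by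
  refine measurable_pi_iff.2 fun n => ?_
  cases n with
  | zero => exact measurable_fst
  | succ n => exact (measurable_pi_apply n).comp measurable_snd

lemma map_seqCons_infinitePi {X : Type*} [MeasurableSpace X] (μ : Measure X)
    [IsProbabilityMeasure μ] :
    (μ.prod (Measure.infinitePi fun _ : ℕ => μ)).map (fun p => seqCons p.1 p.2) =
      Measure.infinitePi fun _ : ℕ => μ := by
  refine Measure.eq_infinitePi _ fun s t ht => ?_
  rw [Measure.map_apply measurable_seqCons (.pi s.countable_toSet fun i _ => ht i)]
  classical
  let s' : Finset ℕ := s.preimage Nat.succ (Nat.succ_injective.injOn)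
  have : (fun p : X × (ℕ → X) => seqCons p.1 p.2) ⁻¹' (Set.pi s t) =
      (if 0 ∈ s then t 0 else Set.univ) ×ˢ (Set.pi s' fun i => t (i + 1)) := by
    ext ⟨a, f⟩
    simp only [Set.mem_preimage, Set.mem_pi, Set.mem_prod]
    constructor
    · intro h
      refine ⟨?_, fun i hi => ?_⟩
      · split_ifs with h0
        · exact h 0 h0
        · trivial
      · exact h (i + 1) (by simpa [s'] using hi)
    · rintro ⟨h0, h1⟩ i hi
      cases i with
      | zero => rw [if_pos (by simpa using hi)] at h0; exact h0
      | succ i => exact h1 i (by simpa [s'] using hi)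
  rw [this, Measure.prod_prod, Measure.infinitePi_pi _ (fun i _ => ht (i + 1))]
  have hs : ∏ i ∈ s, μ (t i) =
      (if 0 ∈ s then μ (t 0) else 1) * ∏ i ∈ s', μ (t (i + 1)) := by
    have h2 : ∏ i ∈ s', μ (t (i + 1)) = ∏ i ∈ s.filter (· ≠ 0), μ (t i) := by
      refine Finset.prod_bij (fun i _ => i + 1) ?_ ?_ ?_ ?_
      · intro i hi; simpa [s'] using hi
      · intro i _ j _ h; simpa using h
      · intro j hj
        obtain ⟨hj, h0⟩ := Finset.mem_filter.1 hj
        obtain ⟨i, rfl⟩ := Nat.exists_eq_succ_of_ne_zero h0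
        exact ⟨i, by simpa [s'] using hj, rfl⟩
      · intros; rfl
    rw [h2, ← Finset.prod_filter_mul_prod_filter_not s (· = 0)]
    congr 1
    split_ifs with h0
    · rw [Finset.filter_eq' s 0, if_pos h0, Finset.prod_singleton]
    · rw [Finset.filter_eq' s 0, if_neg h0, Finset.prod_empty]
  rw [hs]
  split_ifs <;> simp

lemma lintegral_infinitePi_nat {X : Type*} [MeasurableSpace X] (μ : Measure X)
    [IsProbabilityMeasure μ] {f : (ℕ → X) → ℝ≥0∞} (hf : Measurable f) :
    ∫⁻ ω, f ω ∂(Measure.infinitePi fun _ : ℕ => μ) =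
      ∫⁻ a, ∫⁻ ω, f (seqCons a ω) ∂(Measure.infinitePi fun _ : ℕ => μ) ∂μ := by
  conv_lhs => rw [← map_seqCons_infinitePi]
  rw [lintegral_map hf measurable_seqCons,
    lintegral_prod (fun p : X × (ℕ → X) => f (seqCons p.1 p.2))
      (hf.comp measurable_seqCons).aemeasurable]

lemma map_shift_infinitePi {X : Type*} [MeasurableSpace X] (μ : Measure X)
    [IsProbabilityMeasure μ] (j : ℕ) :
    (Measure.infinitePi fun _ : ℕ => μ).map (fun ω n => ω (n + j)) =
      Measure.infinitePi fun _ : ℕ => μ := by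
  refine Measure.eq_infinitePi _ fun s t ht => ?_
  rw [Measure.map_apply (by fun_prop) (.pi s.countable_toSet fun i _ => ht i)]
  have : (fun (ω : ℕ → X) n => ω (n + j)) ⁻¹' (Set.pi s t) =
      Set.pi (s.map (addRightEmbedding j)) fun i => t (i - j) := by
    ext ω
    simp [Set.mem_pi]
  rw [this, Measure.infinitePi_pi _ (fun i _ => ht _), Finset.prod_map]
  simp

/-- Stochastic domination of the factors implies stochastic domination of the product measures. -/
lemma lintegral_pi_le_of_forall_monotone {ι X : Type*} [Fintype ι] [Finite X] [Preorder X]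
    [MeasurableSpace X] [MeasurableSingletonClass X] (μ ν : ι → Measure X)
    [∀ i, IsProbabilityMeasure (μ i)] [∀ i, IsProbabilityMeasure (ν i)]
    (h : ∀ i, ∀ φ : X → ℝ≥0∞, Monotone φ → ∫⁻ a, φ a ∂μ i ≤ ∫⁻ a, φ a ∂ν i)
    {Φ : (ι → X) → ℝ≥0∞} (hΦ : Monotone Φ) :
    ∫⁻ a, Φ a ∂Measure.pi μ ≤ ∫⁻ a, Φ a ∂Measure.pi ν := by
  classical
  have hm : ∀ F : (ι → X) → ℝ≥0∞, Measurable F := fun F => measurable_of_finite F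
  rcases isEmpty_or_nonempty (ι → X) with hE | ⟨⟨x⟩⟩
  · simp [lintegral_of_isEmpty]
  -- The factors are exchanged one at a time. Monotonicity of the partial integral is carried along,
  -- since it is what allows the next factor to be exchanged.
  have key : ∀ s : Finset ι, Monotone (lmarginal ν s Φ) ∧
      lmarginal μ s Φ ≤ lmarginal ν s Φ := by
    intro s
    induction s using Finset.induction with
    | empty => simpa using hΦ
    | insert i s hi ih =>
      constructor
      · intro x y hxy
        rw [lmarginal_insert Φ (hm _) hi, lmarginal_insert Φ (hm _) hi]
        refine lintegral_mono fun a => ih.1 ?_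
        exact update_le_update_iff.2 ⟨le_rfl, fun j _ => hxy j⟩
      · intro x
        rw [lmarginal_insert Φ (hm _) hi, lmarginal_insert Φ (hm _) hi]
        refine (lintegral_mono fun a => ih.2 _).trans (h i _ fun a b hab => ih.1 ?_)
        exact update_le_update_iff.2 ⟨hab, fun j _ => le_rfl⟩
  rw [lintegral_eq_lmarginal_univ x, lintegral_eq_lmarginal_univ x]
  exact (key _).2 x

/-! ### Exponential waiting times. -/

instance : IsProbabilityMeasure (expMeasure 1) := isProbabilityMeasure_expMeasure one_pos

lemma lintegral_expMeasure_one {f : ℝ → ℝ≥0∞} (hf : Measurable f) :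
    ∫⁻ x, f x ∂expMeasure 1 = ∫⁻ x in Set.Ioi 0, ENNReal.ofReal (Real.exp (-x)) * f x := by
  have h0 : expMeasure 1 = volume.withDensity (exponentialPDF 1) := rfl
  have hm : Measurable (exponentialPDF 1) := (measurable_exponentialPDFReal 1).ennreal_ofReal
  rw [h0, lintegral_withDensity_eq_lintegral_mul _ hm hf, restrict_Ioi_eq_restrict_Ici,
    ← lintegral_indicator measurableSet_Ici]
  refine lintegral_congr fun x => ?_
  by_cases hx : 0 ≤ x
  · simp [Set.indicator, hx, exponentialPDF_of_nonneg hx]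
  · simp [Set.indicator, hx, exponentialPDF_of_neg (not_le.1 hx)]

lemma ae_expMeasure_pos : ∀ᵐ x ∂expMeasure 1, 0 < x := by
  have := lintegral_expMeasure_one (f := Set.indicator (Set.Iic 0) 1)
    (measurable_one.indicator measurableSet_Iic)
  rw [lintegral_indicator_one measurableSet_Iic] at this
  rw [ae_iff]
  simp only [not_lt]
  change expMeasure 1 (Set.Iic 0) = 0
  rw [this, setLIntegral_congr_fun (g := 0) measurableSet_Ioi]
  · simp
  · intro x hx
    have : ¬ x ≤ 0 := not_le.2 hx
    simp [this]

/-- Splitting an exponential waiting time at a uniform point gives two exponential waiting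
times. -/
lemma lintegral_expMeasure_add {Ψ : ℝ → ℝ → ℝ≥0∞} (hΨ : Measurable (Function.uncurry Ψ)) :
    ∫⁻ a, ∫⁻ b, Ψ a (a + b) ∂expMeasure 1 ∂expMeasure 1 =
      ∫⁻ e, (∫⁻ a in Set.Ioo 0 e, Ψ a e) ∂expMeasure 1 := by
  have hE : Measurable fun x : ℝ => ENNReal.ofReal (Real.exp (-x)) := by fun_prop
  let g : ℝ → ℝ → ℝ≥0∞ := fun a e =>
    (Set.Ioi (0 : ℝ)).indicator (fun a => (Set.Ioi a).indicator
      (fun e => ENNReal.ofReal (Real.exp (-e)) * Ψ a e) e) a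
  have hg : Measurable (Function.uncurry g) := by
    have : Function.uncurry g = Set.indicator {p : ℝ × ℝ | 0 < p.1 ∧ p.1 < p.2}
        (fun p => ENNReal.ofReal (Real.exp (-p.2)) * Function.uncurry Ψ p) := by
      ext ⟨a, e⟩
      by_cases h1 : 0 < a <;> by_cases h2 : a < e <;> simp [g, Set.indicator, h1, h2]
    rw [this]
    refine Measurable.indicator ((hE.comp measurable_snd).mul hΨ) ?_
    exact (measurableSet_lt measurable_const measurable_fst).inter
      (measurableSet_lt measurable_fst measurable_snd)
  have hL : ∀ a : ℝ, ∫⁻ b, Ψ a (a + b) ∂expMeasure 1 =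
      ∫⁻ b in Set.Ioi 0, ENNReal.ofReal (Real.exp (-b)) * Ψ a (a + b) := fun a =>
    lintegral_expMeasure_one (hΨ.comp (by fun_prop : Measurable fun b => (a, a + b)))
  have hR : ∀ e : ℝ, ∫⁻ a in Set.Ioo 0 e, Ψ a e =
      ∫⁻ a, (Set.Ioo 0 e).indicator (fun a => Ψ a e) a := fun e =>
    (lintegral_indicator measurableSet_Ioo _).symm
  have hm1 : Measurable fun a => ∫⁻ b, Ψ a (a + b) ∂expMeasure 1 := by
    refine Measurable.lintegral_prod_right' (f := fun p : ℝ × ℝ => Ψ p.1 (p.1 + p.2)) ?_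
    exact hΨ.comp (by fun_prop : Measurable fun p : ℝ × ℝ => (p.1, p.1 + p.2))
  have hm2 : Measurable fun e => ∫⁻ a in Set.Ioo 0 e, Ψ a e := by
    simp_rw [hR]
    refine Measurable.lintegral_prod_right'
      (f := fun p : ℝ × ℝ => (Set.Ioo 0 p.1).indicator (fun a => Ψ a p.1) p.2) ?_
    have : (fun p : ℝ × ℝ => (Set.Ioo 0 p.1).indicator (fun a => Ψ a p.1) p.2) =
        Set.indicator {p : ℝ × ℝ | 0 < p.2 ∧ p.2 < p.1} (fun p => Ψ p.2 p.1) := by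
      ext ⟨e, a⟩
      simp [Set.indicator]
    rw [this]
    refine Measurable.indicator (hΨ.comp measurable_swap) ?_
    exact (measurableSet_lt measurable_const measurable_snd).inter
      (measurableSet_lt measurable_snd measurable_fst)
  rw [lintegral_expMeasure_one hm1, lintegral_expMeasure_one hm2]
  -- Since `exp (-a) * exp (-b) = exp (-(a + b))`, the substitution `e = a + b` turns both sides
  -- into the integral of `exp (-e) * Ψ a e` over `0 < a < e`.
  have e1 : ∫⁻ a in Set.Ioi (0 : ℝ), ENNReal.ofReal (Real.exp (-a)) *
      ∫⁻ b, Ψ a (a + b) ∂expMeasure 1 = ∫⁻ a, ∫⁻ e, g a e := by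
    rw [← lintegral_indicator measurableSet_Ioi]
    refine lintegral_congr fun a => ?_
    by_cases ha : 0 < a
    · simp only [g, Set.indicator, Set.mem_Ioi, ha, if_true]
      rw [hL, ← lintegral_const_mul' _ _ ENNReal.ofReal_ne_top,
        ← lintegral_indicator measurableSet_Ioi]
      conv_rhs => rw [← lintegral_add_left_eq_self _ a]
      refine lintegral_congr fun b => ?_
      by_cases hb : 0 < b
      · have : a < a + b := by linarith
        simp only [Set.indicator, Set.mem_Ioi, hb, this, if_true]
        rw [← mul_assoc, ← ENNReal.ofReal_mul (Real.exp_pos _).le, ← Real.exp_add]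
        congr 4
        ring
      · simp [Set.indicator, hb]
    · simp [g, Set.indicator, ha]
  have e2 : ∫⁻ e in Set.Ioi (0 : ℝ), ENNReal.ofReal (Real.exp (-e)) *
      ∫⁻ a in Set.Ioo 0 e, Ψ a e = ∫⁻ e, ∫⁻ a, g a e := by
    rw [← lintegral_indicator measurableSet_Ioi]
    refine lintegral_congr fun e => ?_
    by_cases he : 0 < e
    · simp only [Set.indicator, Set.mem_Ioi, he, if_true]
      rw [hR, ← lintegral_const_mul' _ _ ENNReal.ofReal_ne_top]
      refine lintegral_congr fun a => ?_
      by_cases h1 : 0 < a <;> by_cases h2 : a < e <;> simp [g, Set.indicator, h1, h2]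
    · have : ∀ a, g a e = 0 := by
        intro a
        by_cases h1 : 0 < a
        · have : ¬ a < e := fun h => he (h1.trans h)
          simp [g, Set.indicator, this]
        · simp [g, Set.indicator, h1]
      simp [Set.indicator, he, this]
  rw [e1, e2]
  exact lintegral_lintegral_swap hg.aemeasurable

/-! ### Poisson clocks and the Mecke formula. -/

/-- A row records which vertices are called in which of `W` time windows. -/
abbrev Row (W : ℕ) (V : Type*) := Fin W → V → Prop

section Clock

variable {V : Type*} {W : ℕ}

/-- The row of a clock started at time `s`, for the time windows `B`. -/
def clockRow (B : Fin W → Set ℝ) (s : ℝ) (f : ℕ → ℝ × V) : Row W V :=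
  fun j y => ∃ k, s + ∑ i ∈ Finset.range (k + 1), (f i).1 ∈ B j ∧ (f k).2 = y

/-- The row with a single call, at time `a` to the vertex `y`. -/
def callRow (B : Fin W → Set ℝ) (a : ℝ) (y : V) : Row W V := fun j z => a ∈ B j ∧ z = y

lemma clockRow_seqCons (B : Fin W → Set ℝ) (s : ℝ) (p : ℝ × V) (f : ℕ → ℝ × V) :
    clockRow B s (seqCons p f) = clockRow B (s + p.1) f ⊔ callRow B (s + p.1) p.2 := by
  funext j y
  refine propext ⟨?_, ?_⟩
  · rintro ⟨k, h1, h2⟩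
    cases k with
    | zero => exact Or.inr ⟨by simpa using h1, by simpa using h2.symm⟩
    | succ k =>
      refine Or.inl ⟨k, ?_, h2⟩
      rw [Finset.sum_range_succ'] at h1
      simpa [add_comm, add_left_comm, add_assoc] using h1
  · rintro (⟨k, h1, h2⟩ | ⟨h1, h2⟩)
    · refine ⟨k + 1, ?_, h2⟩
      rw [Finset.sum_range_succ']
      simpa [add_comm, add_left_comm, add_assoc] using h1
    · exact ⟨0, by simpa using h1, h2.symm⟩

variable [Fintype V] [MeasurableSpace V] [DiscreteMeasurableSpace V]

lemma measurable_clockRow {B : Fin W → Set ℝ} (hB : ∀ j, MeasurableSet (B j)) :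
    Measurable fun p : ℝ × (ℕ → ℝ × V) => clockRow B p.1 p.2 := by
  refine measurable_pi_iff.2 fun j => measurable_pi_iff.2 fun y => ?_
  refine measurable_to_prop ?_
  have : (fun p : ℝ × (ℕ → ℝ × V) => clockRow B p.1 p.2 j y) ⁻¹' {True} =
      ⋃ k : ℕ, {p | p.1 + ∑ i ∈ Finset.range (k + 1), (p.2 i).1 ∈ B j} ∩ {p | (p.2 k).2 = y} := by
    ext p
    simp [clockRow]
  rw [this]
  refine MeasurableSet.iUnion fun k => MeasurableSet.inter ?_ ?_
  · have : Measurable fun p : ℝ × (ℕ → ℝ × V) =>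
        p.1 + ∑ i ∈ Finset.range (k + 1), (p.2 i).1 := by fun_prop
    exact this (hB j)
  · have : Measurable fun p : ℝ × (ℕ → ℝ × V) => (p.2 k).2 := by fun_prop
    exact this (measurableSet_singleton y)

lemma measurable_callRow {B : Fin W → Set ℝ} (hB : ∀ j, MeasurableSet (B j)) :
    Measurable fun p : ℝ × V => callRow B p.1 p.2 := by
  refine measurable_pi_iff.2 fun j => measurable_pi_iff.2 fun y => ?_
  refine measurable_to_prop ?_
  have : (fun p : ℝ × V => callRow B p.1 p.2 j y) ⁻¹' {True} = (B j) ×ˢ {y} := by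
    ext p
    simp [callRow, eq_comm]
  rw [this]
  exact (hB j).prod (measurableSet_singleton y)

lemma measurable_uncurry_row {V : Type*} {W : ℕ} {E : Type*} [MeasurableSpace E] [Finite V]
    {F : E → Row W V → ℝ≥0∞}
    (hF : ∀ r, Measurable fun a => F a r) : Measurable (Function.uncurry F) :=
  measurable_from_prod_countable_left hF

variable (ν : Measure V) [IsProbabilityMeasure ν]

open Classical in
/-- The Mecke formula for the `k`-th ring of a Poisson clock. -/
lemma lintegral_ring {B : Fin W → Set ℝ} (hB : ∀ j, MeasurableSet (B j)) (y : V) (k : ℕ) :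
    ∀ (s : ℝ) (F : ℝ → Row W V → ℝ≥0∞) (_ : ∀ r, Measurable fun a => F a r),
    ∫⁻ f, (if (f k).2 = y then
        F (s + ∑ i ∈ Finset.range (k + 1), (f i).1) (clockRow B s f) else 0)
        ∂(Measure.infinitePi fun _ : ℕ => (expMeasure 1).prod ν) =
      ν {y} * ∫⁻ f, (∫⁻ a in Set.Ioo (s + ∑ i ∈ Finset.range k, (f i).1)
        (s + ∑ i ∈ Finset.range (k + 1), (f i).1), F a (clockRow B s f ⊔ callRow B a y))
        ∂(Measure.infinitePi fun _ : ℕ => (expMeasure 1).prod ν) := by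
  have hrow := measurable_clockRow (V := V) hB
  have hcall := measurable_callRow (V := V) hB
  have hsup : Measurable fun p : Row W V × Row W V => p.1 ⊔ p.2 := measurable_of_countable _
  have hgap : ∀ (k : ℕ) (s : ℝ) (F : ℝ → Row W V → ℝ≥0∞) (_ : ∀ r, Measurable fun a => F a r),
      Measurable fun f : ℕ → ℝ × V => ∫⁻ a in Set.Ioo (s + ∑ i ∈ Finset.range k, (f i).1)
        (s + ∑ i ∈ Finset.range (k + 1), (f i).1), F a (clockRow B s f ⊔ callRow B a y) := by
    intro k s F hF
    simp_rw [← lintegral_indicator measurableSet_Ioo]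
    refine Measurable.lintegral_prod_right' (f := fun p : (ℕ → ℝ × V) × ℝ =>
      (Set.Ioo (s + ∑ i ∈ Finset.range k, (p.1 i).1)
        (s + ∑ i ∈ Finset.range (k + 1), (p.1 i).1)).indicator
          (fun a => F a (clockRow B s p.1 ⊔ callRow B a y)) p.2) ?_
    have : (fun p : (ℕ → ℝ × V) × ℝ => (Set.Ioo (s + ∑ i ∈ Finset.range k, (p.1 i).1)
        (s + ∑ i ∈ Finset.range (k + 1), (p.1 i).1)).indicator
          (fun a => F a (clockRow B s p.1 ⊔ callRow B a y)) p.2) =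
        Set.indicator {p | s + ∑ i ∈ Finset.range k, (p.1 i).1 < p.2 ∧
          p.2 < s + ∑ i ∈ Finset.range (k + 1), (p.1 i).1}
          (fun p => Function.uncurry F (p.2, clockRow B s p.1 ⊔ callRow B p.2 y)) := by
      ext p
      simp [Set.indicator]
    rw [this]
    refine Measurable.indicator ?_ ?_
    · refine (measurable_uncurry_row hF).comp (measurable_snd.prodMk (hsup.comp
        (Measurable.prodMk (hrow.comp (measurable_const.prodMk measurable_fst))
          (hcall.comp (measurable_snd.prodMk measurable_const)))))
    · exact (measurableSet_lt (by fun_prop) measurable_snd).inter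
        (measurableSet_lt measurable_snd (by fun_prop))
  have hring : ∀ (k : ℕ) (s : ℝ) (F : ℝ → Row W V → ℝ≥0∞) (_ : ∀ r, Measurable fun a => F a r),
      Measurable fun f : ℕ → ℝ × V => if (f k).2 = y then
        F (s + ∑ i ∈ Finset.range (k + 1), (f i).1) (clockRow B s f) else 0 := by
    intro k s F hF
    refine Measurable.ite ?_ ?_ measurable_const
    · have : Measurable fun f : ℕ → ℝ × V => (f k).2 := by fun_prop
      exact this (measurableSet_singleton y)
    · refine (measurable_uncurry_row hF).comp (Measurable.prodMk (by fun_prop)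
        (hrow.comp (measurable_const.prodMk measurable_id)))
  induction k with
  | zero =>
    intro s F hF
    set μ := Measure.infinitePi fun _ : ℕ => (expMeasure 1).prod ν with hμ
    -- `H ((a, b), (v, f))` describes a clock that rings at `s + a` with callee `y`, at `s + b` with
    -- callee `v`, and then follows `f`. On the left, `a` and `b - a` are independent exponential
    -- times. On the right, `b` is exponential and `a` is integrated over the gap before it.
    -- `lintegral_expMeasure_add` identifies the two.
    let H : (ℝ × ℝ) × (V × (ℕ → ℝ × V)) → ℝ≥0∞ := fun q => F (s + q.1.1)
      (clockRow B (s + q.1.2) q.2.2 ⊔ callRow B (s + q.1.2) q.2.1 ⊔ callRow B (s + q.1.1) y)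
    have hH : Measurable H := by
      refine (measurable_uncurry_row hF).comp (Measurable.prodMk (by fun_prop)
        (hsup.comp (Measurable.prodMk (hsup.comp (Measurable.prodMk
          (hrow.comp (Measurable.prodMk (by fun_prop) (by fun_prop)))
          (hcall.comp (Measurable.prodMk (by fun_prop) (by fun_prop)))))
          (hcall.comp (Measurable.prodMk (by fun_prop) (by fun_prop))))))
    let Ψ : ℝ → ℝ → ℝ≥0∞ := fun a b => ∫⁻ q, H ((a, b), q) ∂(ν.prod μ)
    have hΨ : Measurable (Function.uncurry Ψ) :=
      Measurable.lintegral_prod_right' (f := H) hH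
    have h1 : ∀ e : ℝ, ∫⁻ f, F (s + e) (clockRow B (s + e) f ⊔ callRow B (s + e) y) ∂μ =
        ∫⁻ b, Ψ e (e + b) ∂expMeasure 1 := by
      intro e
      have hm : Measurable fun f => F (s + e) (clockRow B (s + e) f ⊔ callRow B (s + e) y) :=
        (measurable_uncurry_row hF).comp (Measurable.prodMk measurable_const
          (hsup.comp (Measurable.prodMk (hrow.comp (measurable_const.prodMk measurable_id))
            measurable_const)))
      rw [hμ, lintegral_infinitePi_nat _ hm, ← hμ, lintegral_prod _ ?_]
      · refine lintegral_congr fun b => ?_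
        simp only [Ψ]
        rw [lintegral_prod _ (by
          exact (hH.comp (measurable_const.prodMk measurable_id)).aemeasurable)]
        simp only [H, clockRow_seqCons, add_assoc]
      · refine Measurable.aemeasurable ?_
        refine Measurable.lintegral_prod_right' (f := fun p : (ℝ × V) × (ℕ → ℝ × V) =>
          F (s + e) (clockRow B (s + e) (seqCons p.1 p.2) ⊔ callRow B (s + e) y)) ?_
        exact hm.comp measurable_seqCons
    have h2 : ∀ b : ℝ, ∫⁻ v, ∫⁻ f, (∫⁻ a in Set.Ioo s (s + b), F a (clockRow B (s + b) f ⊔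
        callRow B (s + b) v ⊔ callRow B a y)) ∂μ ∂ν = ∫⁻ a in Set.Ioo 0 b, Ψ a b := by
      intro b
      have h3 : ∀ v f, (∫⁻ a in Set.Ioo s (s + b), F a (clockRow B (s + b) f ⊔
          callRow B (s + b) v ⊔ callRow B a y)) = ∫⁻ a in Set.Ioo 0 b, H ((a, b), (v, f)) := by
        intro v f
        rw [← lintegral_indicator measurableSet_Ioo, ← lintegral_indicator measurableSet_Ioo,
          ← lintegral_add_left_eq_self _ s]
        refine lintegral_congr fun a => ?_
        simp [Set.indicator, H]
      simp_rw [h3]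
      have hmq : Measurable fun p : (V × (ℕ → ℝ × V)) × ℝ => H ((p.2, b), p.1) :=
        hH.comp (by fun_prop)
      rw [← lintegral_prod (fun q : V × (ℕ → ℝ × V) => ∫⁻ a in Set.Ioo 0 b, H ((a, b), q))
        (hmq.lintegral_prod_right').aemeasurable]
      exact lintegral_lintegral_swap hmq.aemeasurable
    rw [hμ, lintegral_infinitePi_nat _ (hring 0 s F hF), lintegral_infinitePi_nat _ (hgap 0 s F hF),
      ← hμ]
    simp only [clockRow_seqCons, seqCons_zero, Finset.range_zero, Finset.sum_empty, zero_add,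
      Finset.range_one, Finset.sum_singleton, add_zero]
    rw [lintegral_prod _ ?_, lintegral_prod _ ?_]
    · simp_rw [h2]
      rw [← lintegral_expMeasure_add hΨ]
      simp_rw [← h1]
      rw [← lintegral_const_mul' _ _ (measure_ne_top _ _)]
      refine lintegral_congr fun e => ?_
      rw [lintegral_countable']
      rw [tsum_eq_single y]
      · simp [mul_comm]
      · intro v hv
        simp [hv]
    · have := (hgap 0 s F hF).comp (measurable_seqCons (X := ℝ × V))
      simpa [Function.comp_def, clockRow_seqCons] using this.lintegral_prod_right'.aemeasurable
    · have := (hring 0 s F hF).comp (measurable_seqCons (X := ℝ × V))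
      simpa [Function.comp_def, clockRow_seqCons] using this.lintegral_prod_right'.aemeasurable
  | succ k ih =>
    intro s F hF
    rw [lintegral_infinitePi_nat _ (hring (k + 1) s F hF),
      lintegral_infinitePi_nat _ (hgap (k + 1) s F hF),
      ← lintegral_const_mul' _ _ (measure_ne_top _ _)]
    refine lintegral_congr fun p => ?_
    have e1 : ∀ (k : ℕ) (f : ℕ → ℝ × V), s + ∑ i ∈ Finset.range (k + 1), (seqCons p f i).1 =
        s + p.1 + ∑ i ∈ Finset.range k, (f i).1 := by
      intro k f
      rw [Finset.sum_range_succ']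
      simp only [seqCons_succ, seqCons_zero]
      ring
    simp only [e1, seqCons_succ, clockRow_seqCons]
    rw [ih (s + p.1) (fun a r => F a (r ⊔ callRow B (s + p.1) p.2)) fun r => hF _]
    simp only [sup_right_comm]

/-- The law of the row of a clock is dominated by adding a single call. -/
lemma lintegral_clockRow_le {B : Fin W → Set ℝ} (hB : ∀ j, MeasurableSet (B j))
    (hd : ∀ a i j, a ∈ B i → a ∈ B j → i = j) (j : Fin W) (y : V) (h : Row W V → ℝ≥0∞) :
    ∫⁻ f, {r : Row W V | r j y}.indicator h (clockRow B 0 f)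
        ∂(Measure.infinitePi fun _ : ℕ => (expMeasure 1).prod ν) ≤
      volume (B j) * ν {y} * ∫⁻ f, h (clockRow B 0 f ⊔ fun i z => i = j ∧ z = y)
        ∂(Measure.infinitePi fun _ : ℕ => (expMeasure 1).prod ν) := by
  classical
  set μ := Measure.infinitePi fun _ : ℕ => (expMeasure 1).prod ν with hμ
  have hrow : Measurable fun f : ℕ → ℝ × V => clockRow B 0 f :=
    (measurable_clockRow (V := V) hB).comp (measurable_const.prodMk measurable_id)
  have hh : ∀ g : Row W V → ℝ≥0∞, Measurable g := fun g => measurable_of_countable g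
  let F : ℝ → Row W V → ℝ≥0∞ := fun a r => (B j).indicator (fun _ => h r) a
  have hF : ∀ r, Measurable fun a => F a r := fun r => measurable_const.indicator (hB j)
  -- As the windows are disjoint, an extra ring anywhere in `B j` adds the same single entry to the
  -- row, so the integral over its time reduces to a volume.
  have hcall : ∀ a ∈ B j, callRow B a y = fun i z => i = j ∧ z = y := by
    intro a ha
    funext i z
    exact propext ⟨fun ⟨h1, h2⟩ => ⟨hd a _ _ h1 ha, h2⟩, fun ⟨h1, h2⟩ => ⟨h1 ▸ ha, h2⟩⟩
  have hpos : ∀ᵐ f ∂μ, ∀ i, 0 ≤ (f i).1 := by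
    refine ae_all_iff.2 fun i => ?_
    have h1 : ∀ᵐ p ∂((expMeasure 1).prod ν), 0 ≤ p.1 := by
      have := (Measure.quasiMeasurePreserving_fst (μ := expMeasure 1) (ν := ν)).ae
        (ae_expMeasure_pos)
      exact this.mono fun p hp => le_of_lt hp
    exact (measurePreserving_eval_infinitePi (fun _ : ℕ => (expMeasure 1).prod ν)
      i).quasiMeasurePreserving.ae h1
  calc ∫⁻ f, {r : Row W V | r j y}.indicator h (clockRow B 0 f) ∂μ
      ≤ ∫⁻ f, ∑' k, (if (f k).2 = y then
        F (0 + ∑ i ∈ Finset.range (k + 1), (f i).1) (clockRow B 0 f) else 0) ∂μ := by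
        refine lintegral_mono fun f => ?_
        by_cases hf : clockRow B 0 f j y
        · obtain ⟨k, h1, h2⟩ := hf
          refine le_trans ?_ (ENNReal.le_tsum k)
          rw [if_pos h2]
          simp only [F, Set.indicator_of_mem h1]
          exact Set.indicator_le_self _ _ _
        · simp [Set.indicator, hf]
    _ = ∑' k, ∫⁻ f, (if (f k).2 = y then
        F (0 + ∑ i ∈ Finset.range (k + 1), (f i).1) (clockRow B 0 f) else 0) ∂μ := by
        refine lintegral_tsum fun k => Measurable.aemeasurable ?_
        refine Measurable.ite ?_ ?_ measurable_const
        · have : Measurable fun f : ℕ → ℝ × V => (f k).2 := by fun_prop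
          exact this (measurableSet_singleton y)
        · exact (measurable_uncurry_row hF).comp (Measurable.prodMk (by fun_prop) hrow)
    _ = ∑' k, ν {y} * ∫⁻ f, volume (Set.Ioo (0 + ∑ i ∈ Finset.range k, (f i).1)
        (0 + ∑ i ∈ Finset.range (k + 1), (f i).1) ∩ B j) *
          h (clockRow B 0 f ⊔ fun i z => i = j ∧ z = y) ∂μ := by
        refine tsum_congr fun k => ?_
        rw [lintegral_ring ν hB y k 0 F hF]
        congr 1
        refine lintegral_congr fun f => ?_
        have : ∀ a, F a (clockRow B 0 f ⊔ callRow B a y) = (B j).indicator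
            (fun _ => h (clockRow B 0 f ⊔ fun i z => i = j ∧ z = y)) a := by
          intro a
          by_cases ha : a ∈ B j
          · simp only [F, Set.indicator_of_mem ha, hcall a ha]
          · simp [F, ha]
        simp_rw [this]
        rw [lintegral_indicator_const (hB j), Measure.restrict_apply (hB j), mul_comm,
          Set.inter_comm]
    _ = ν {y} * ∫⁻ f, ∑' k, volume (Set.Ioo (0 + ∑ i ∈ Finset.range k, (f i).1)
        (0 + ∑ i ∈ Finset.range (k + 1), (f i).1) ∩ B j) *
          h (clockRow B 0 f ⊔ fun i z => i = j ∧ z = y) ∂μ := by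
        rw [ENNReal.tsum_mul_left, lintegral_tsum]
        intro k
        refine Measurable.aemeasurable (Measurable.mul ?_
          ((hh fun r => h (r ⊔ fun i z => i = j ∧ z = y)).comp hrow))
        have : ∀ f : ℕ → ℝ × V, Set.Ioo (0 + ∑ i ∈ Finset.range k, (f i).1)
            (0 + ∑ i ∈ Finset.range (k + 1), (f i).1) ∩ B j =
            Prod.mk f ⁻¹' {p : (ℕ → ℝ × V) × ℝ | 0 + ∑ i ∈ Finset.range k, (p.1 i).1 < p.2 ∧
              p.2 < 0 + ∑ i ∈ Finset.range (k + 1), (p.1 i).1 ∧ p.2 ∈ B j} := by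
          intro f
          ext a
          simp [and_assoc]
        simp_rw [this]
        refine measurable_measure_prodMk_left ?_
        exact (measurableSet_lt (by fun_prop) measurable_snd).inter
          ((measurableSet_lt measurable_snd (by fun_prop)).inter (measurable_snd (hB j)))
    _ ≤ ν {y} * ∫⁻ f, volume (B j) * h (clockRow B 0 f ⊔ fun i z => i = j ∧ z = y) ∂μ := by
        gcongr ν {y} * ?_
        refine lintegral_mono_ae (hpos.mono fun f hf => ?_)
        rw [ENNReal.tsum_mul_right]
        gcongr ?_ * _
        -- The gaps between successive rings are disjoint, so their parts inside `B j` have total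
        -- volume at most that of `B j`.
        have hmono : Monotone fun k => 0 + ∑ i ∈ Finset.range k, (f i).1 := by
          refine monotone_nat_of_le_succ fun k => ?_
          rw [Finset.sum_range_succ]
          linarith [hf k]
        rw [← measure_iUnion]
        · exact measure_mono (Set.iUnion_subset fun k => Set.inter_subset_right)
        · intro k l hkl
          exact (hmono.pairwise_disjoint_on_Ioo_succ hkl).mono Set.inter_subset_left
            Set.inter_subset_left
        · exact fun k => measurableSet_Ioo.inter (hB j)
    _ = _ := by
        have hm : Measurable fun f => h (clockRow B 0 f ⊔ fun i z => i = j ∧ z = y) :=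
          (hh fun r => h (r ⊔ fun i z => i = j ∧ z = y)).comp hrow
        rw [lintegral_const_mul _ hm,
          ← mul_assoc, mul_comm (ν {y})]

end Clock
-- Windows and their exploration in levels.
/-- The law of a coin that shows `true` with probability `p`. -/
noncomputable def coin (p : ℝ≥0∞) : Measure Bool :=
  p • Measure.dirac true + (1 - p) • Measure.dirac false

lemma isProbabilityMeasure_coin {p : ℝ≥0∞} (hp : p ≤ 1) : IsProbabilityMeasure (coin p) :=
  ⟨by simp [coin, add_tsub_cancel_of_le hp]⟩

lemma lintegral_coin (p : ℝ≥0∞) (f : Bool → ℝ≥0∞) :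
    ∫⁻ b, f b ∂coin p = p * f true + (1 - p) * f false := by
  simp [coin]

/-- The vertices reached from `I` when every call `E x y` can be used in both directions. -/
inductive Reach {V : Type*} (E : V → V → Prop) (I : Set V) : V → Prop
  | base {v : V} : v ∈ I → Reach E I v
  | push {x y : V} : Reach E I x → E x y → Reach E I y
  | pull {x y : V} : Reach E I y → E x y → Reach E I x

lemma Reach.mono {V : Type*} {E E' : V → V → Prop} {I I' : Set V} (hE : ∀ x y, E x y → E' x y)
    (hI : I ⊆ I') {v : V} (h : Reach E I v) : Reach E' I' v := by
  induction h with
  | base h => exact .base (hI h)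
  | push _ h ih => exact .push ih (hE _ _ h)
  | pull _ h ih => exact .pull ih (hE _ _ h)

/-- The vertices reached after `k` windows, starting with window `w`, where `E w` are the calls
of window `w`. -/
def windows {V : Type*} (E : ℕ → V → V → Prop) : ℕ → ℕ → Set V → Set V
  | 0, _, S => S
  | k + 1, w, S => windows E k (w + 1) {v | Reach (E w) S v}

lemma windows_mono {V : Type*} {E E' : ℕ → V → V → Prop} (k : ℕ) :
    ∀ (w : ℕ) {S S' : Set V}, (∀ i, w ≤ i → ∀ x y, E i x y → E' i x y) → S ⊆ S' →
      windows E k w S ⊆ windows E' k w S' := by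
  induction k with
  | zero => exact fun w S S' _ h => h
  | succ k ih =>
    intro w S S' hE hS
    exact ih (w + 1) (fun i hi => hE i (by omega)) fun v hv => Reach.mono (hE w le_rfl) hS hv

/-- The calls recorded by a row in window `w` (none if there is no such window). -/
def Row.called {V : Type*} {W : ℕ} (r : Row W V) (w : ℕ) (y : V) : Prop :=
  ∃ h : w < W, r ⟨w, h⟩ y

/-- The row consisting of a single call to `y` in window `w`. -/
def Row.single {V : Type*} (W : ℕ) (w : ℕ) (y : V) : Row W V := fun i z => (i : ℕ) = w ∧ z = y

/-- The calls recorded by a row in the windows after `w`. -/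
def Row.after {V : Type*} {W : ℕ} (r : Row W V) (w : ℕ) : Row W V := fun i z => w < (i : ℕ) ∧ r i z

lemma Row.after_sup_single {V : Type*} {W : ℕ} (r : Row W V) (w : ℕ) (y : V) :
    (r ⊔ Row.single W w y).after w = r.after w := by
  funext i z
  refine propext ⟨?_, fun h => ⟨h.1, Or.inl h.2⟩⟩
  rintro ⟨h, h' | h'⟩
  · exact ⟨h, h'⟩
  · exact absurd h'.1 (by omega)

lemma Row.called_sup_single_imp {V : Type*} {W : ℕ} {r : Row W V} {w : ℕ} {y z : V}
    (h : (r ⊔ Row.single W w y).called w z) : r.called w z ∨ z = y := by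
  obtain ⟨h, h1 | h1⟩ := h
  · exact Or.inl ⟨h, h1⟩
  · exact Or.inr h1.2

/-- The state of the level exploration: `k` windows are left including the current window `w`,
the vertices `I` are informed, the vertices `A` may still call in the current window, and the
vertices `D` may still be called by uninformed vertices in the current window. -/
structure State (V : Type*) where
  k : ℕ
  w : ℕ
  I : Set V
  A : Set V
  D : Set V

instance {V : Type*} : MeasurableSpace (State V) := ⊤

namespace State

variable {V : Type*}

/-- The calls of the current window that have not been explored. -/
def unexplored {W : ℕ} (σ : State V) (R : V → Row W V) (x y : V) : Prop :=
  (R x).called σ.w y ∧ (x ∈ σ.A ∨ (x ∉ σ.I ∧ (y ∈ σ.I → y ∈ σ.D)))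

/-- The vertices informed at the end of the last window. -/
def final {W : ℕ} (σ : State V) (R : V → Row W V) : Set V :=
  match σ.k with
  | 0 => σ.I
  | k + 1 => windows (fun i x y => (R x).called i y) k (σ.w + 1)
      {v | Reach (σ.unexplored R) σ.I v}

/-- The informed vertices after one level of the exploration in which `v` may use the call
`(z v).1` if `(z v).2`. -/
def nextInformed (σ : State V) (z : V → V × Bool) : Set V :=
  σ.I ∪ {v | (∃ x ∈ σ.A, (z x).2 = true ∧ (z x).1 = v) ∨
    (v ∉ σ.I ∧ (z v).2 = true ∧ (z v).1 ∈ σ.D)}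

open Classical in
/-- One level of the exploration. -/
noncomputable def step (σ : State V) (z : V → V × Bool) : State V :=
  match σ.k with
  | 0 => σ
  | k + 1 => if σ.A = ∅ then ⟨k, σ.w + 1, σ.I, σ.I, σ.I⟩ else
      ⟨k + 1, σ.w, σ.nextInformed z, {x ∈ σ.A | (z x).2 = true} ∪ (σ.nextInformed z \ σ.I),
        σ.nextInformed z \ σ.I⟩

/-- A state is valid if vertices are active only when informed and fresh only when active. -/
def Valid (σ : State V) : Prop := σ.D ⊆ σ.A ∧ σ.A ⊆ σ.I

lemma Valid.step {σ : State V} (h : σ.Valid) (z : V → V × Bool) : (σ.step z).Valid := by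
  rcases σ with ⟨_ | k, w, I, A, D⟩
  · exact h
  · by_cases hA : A = ∅
    · simp [State.step, hA, Valid]
    · simp only [State.step, hA, if_false]
      refine ⟨Set.subset_union_right, Set.union_subset ?_ Set.sdiff_subset⟩
      exact fun x hx => Or.inl (h.2 hx.1)

/-- Without active and fresh vertices no unexplored call joins `I` to its complement, so the window
is over. In the next window all informed vertices are active and fresh, so no call there is lost. -/
lemma final_step_of_empty {W : ℕ} (k w : ℕ) (I D : Set V) (h : D ⊆ ∅) (z : V → V × Bool)
    (R : V → Row W V) :
    (State.mk (k + 1) w I ∅ D).final R ⊆ ((State.mk (k + 1) w I ∅ D).step z).final R := by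
  obtain rfl : D = ∅ := Set.subset_empty_iff.1 h
  have h1 : {v | Reach ((State.mk (k + 1) w I ∅ ∅).unexplored R) I v} ⊆ I := by
    intro v hv
    induction hv with
    | base h => exact h
    | push _ h ih =>
      obtain ⟨_, h | h⟩ := h
      · exact absurd h (by simp)
      · exact absurd ih h.1
    | pull _ h ih =>
      obtain ⟨_, h | h⟩ := h
      · exact absurd h (by simp)
      · exact absurd (h.2 ih) (by simp)
  simp only [final, State.step, if_true]
  cases k with
  | zero => exact h1
  | succ k =>
    refine windows_mono k (w + 1 + 1) (fun _ _ _ _ h => h) (fun v hv => ?_)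
    refine Reach.mono (fun x y hxy => ⟨hxy, ?_⟩) h1 hv
    by_cases hx : x ∈ I
    · exact Or.inl hx
    · exact Or.inr ⟨hx, fun hy => hy⟩

end State

/-! ### Domination of one level by fresh calls. -/

/-- Vertex-wise information about one level of the exploration: whether the vertex becomes
informed by its own call, the calls that remain in the window, and the calls in later windows. -/
abbrev LevelData (W : ℕ) (V : Type*) := Prop × (V → Prop) × Row W V

namespace State

variable {V : Type*} {W : ℕ}

/-- The level data before the level is explored. -/
def dataBefore (σ : State V) (x : V) (r : Row W V) : LevelData W V :=
  (x ∉ σ.I ∧ ∃ y ∈ σ.D, r.called σ.w y,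
    fun y => r.called σ.w y ∧ (x ∈ σ.A ∨ (x ∉ σ.I ∧ y ∉ σ.I)), r.after σ.w)

/-- The level data after the level is explored. -/
def dataAfter (σ : State V) (x : V) (q : (V × Bool) × Row W V) : LevelData W V :=
  (x ∉ σ.I ∧ q.1.2 = true ∧ q.1.1 ∈ σ.D,
    fun y => (x ∈ σ.A ∧ q.1.2 = true ∧ (q.2.called σ.w y ∨ y = q.1.1)) ∨
      (q.2.called σ.w y ∧ x ∉ σ.I ∧ y ∉ σ.I), q.2.after σ.w)

/-- The final informed set computed from level data. -/
def finalOfData (k w : ℕ) (I : Set V) (d : V → LevelData W V) : Set V :=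
  windows (fun i x y => (d x).2.2.called i y) k (w + 1)
    {v | Reach (fun x y => (d x).2.1 y) (I ∪ {v | (d v).1}) v}

lemma finalOfData_mono (k w : ℕ) (I : Set V) : Monotone (finalOfData (W := W) k w I) := by
  intro d d' h
  refine windows_mono k _ (fun i _ x y ⟨hi, hy⟩ => ⟨hi, (h x).2.2 _ _ hy⟩) fun v hv => ?_
  exact Reach.mono (fun x y hxy => (h x).2.1 _ hxy)
    (Set.union_subset_union_right _ fun v hv => (h v).1 hv) hv

/-- An unexplored call from an uninformed vertex to an informed one can only go to a fresh vertex.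
It makes its caller informed and is recorded by the first component of the data, so the second
component may omit it. -/
lemma final_subset_finalOfData (k w : ℕ) (I A D : Set V) (R : V → Row W V) :
    (State.mk (k + 1) w I A D).final R ⊆
      finalOfData k w I fun x => (State.mk (k + 1) w I A D).dataBefore x (R x) := by
  refine windows_mono k _ (fun i hi x y ⟨h, hy⟩ => ⟨h, hi, hy⟩) fun v hv => ?_
  induction hv with
  | base h => exact .base (Or.inl h)
  | @push x y _ h ih =>
    obtain ⟨hc, h | h⟩ := h
    · exact .push ih ⟨hc, Or.inl h⟩
    · by_cases hy : y ∈ I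
      · exact .base (Or.inl hy)
      · exact .push ih ⟨hc, Or.inr ⟨h.1, hy⟩⟩
  | @pull x y _ h ih =>
    obtain ⟨hc, h | h⟩ := h
    · exact .pull ih ⟨hc, Or.inl h⟩
    · by_cases hy : y ∈ I
      · exact .base (Or.inr ⟨h.1, y, h.2 hy, hc⟩)
      · exact .pull ih ⟨hc, Or.inr ⟨h.1, hy⟩⟩

/-- Every call left in the data either is unexplored in the next state or joins two vertices that
are informed there, where it is useless. The second case occurs for the call an active vertex has
just used. -/
lemma finalOfData_subset_final_step (k w : ℕ) (I A D : Set V) (hA : A ≠ ∅)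
    (hI : A ⊆ I) (z : V → V × Bool) (R : V → Row W V) :
    (finalOfData k w I fun x => (State.mk (k + 1) w I A D).dataAfter x (z x, R x)) ⊆
      ((State.mk (k + 1) w I A D).step z).final R := by
  simp only [State.step, hA, if_false, final]
  refine windows_mono k _ (fun i hi x y ⟨h, hy⟩ => ⟨h, hy.2⟩) fun v hv => ?_
  set σ := State.mk (k + 1) w I A D with hσ
  have hflag : ∀ v, v ∈ I ∪ {v | v ∉ I ∧ (z v).2 = true ∧ (z v).1 ∈ D} →
      v ∈ σ.nextInformed z := by
    rintro v (h | h)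
    · exact Or.inl h
    · exact Or.inr (Or.inr h)
  have hedge : ∀ x y, (σ.dataAfter x (z x, R x)).2.1 y →
      (State.mk (k + 1) w (σ.nextInformed z) ({x ∈ A | (z x).2 = true} ∪ (σ.nextInformed z \ I))
        (σ.nextInformed z \ I)).unexplored R x y ∨
      (x ∈ σ.nextInformed z ∧ y ∈ σ.nextInformed z) := by
    rintro x y (⟨h1, h2, h3 | h3⟩ | ⟨h1, h2, h3⟩)
    · exact Or.inl ⟨h3, Or.inl (Or.inl ⟨h1, h2⟩)⟩
    · exact Or.inr ⟨Or.inl (hI h1), Or.inr (Or.inl ⟨x, h1, h2, h3.symm⟩)⟩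
    · by_cases hx : x ∈ σ.nextInformed z
      · exact Or.inl ⟨h1, Or.inl (Or.inr ⟨hx, h2⟩)⟩
      · exact Or.inl ⟨h1, Or.inr ⟨hx, fun hy => ⟨hy, h3⟩⟩⟩
  induction hv with
  | base h => exact .base (hflag _ h)
  | push _ h ih =>
    rcases hedge _ _ h with h | h
    · exact .push ih h
    · exact .base h.2
  | pull _ h ih =>
    rcases hedge _ _ h with h | h
    · exact .pull ih h
    · exact .base h.1

end State

/-- Adding a call costs at most its rate: the property of the law of the rows of Poisson clocks
that is used in the exploration. -/
def MeckeLaw {V : Type*} [MeasurableSpace V] {W : ℕ} (p : ℝ≥0∞) (κ : Measure V)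
    (ρ : Measure (Row W V)) : Prop :=
  ∀ (w : ℕ) (y : V) (h : Row W V → ℝ≥0∞),
    ∫⁻ r, {r : Row W V | r.called w y}.indicator h r ∂ρ ≤
      p * κ {y} * ∫⁻ r, h (r ⊔ Row.single W w y) ∂ρ

section

variable {V : Type*} [Fintype V] [MeasurableSpace V] [DiscreteMeasurableSpace V] {W : ℕ}

-- Here `g` is the value with the calls to `Y` revealed and `f` the value without them. The excess
-- `g - f` is nonzero only if some `y ∈ Y` is called. A union bound over `y` and the Mecke
-- inequality bound its mean by the sum over `y ∈ Y` of `p * κ {y}` times the mean of `g (r ⊔ single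
-- y) - f r`. This is the excess in an experiment with a coin, a call and an unconditioned row.
open Classical in
lemma MeckeLaw.lintegral_le {p : ℝ≥0∞} (hp : p ≤ 1) {κ : Measure V} [IsProbabilityMeasure κ]
    {ρ : Measure (Row W V)} [IsProbabilityMeasure ρ] (hρ : MeckeLaw p κ ρ) (w : ℕ)
    (f g : Row W V → ℝ≥0∞) (hfg : ∀ r, f r ≤ g r) (Y : Set V)
    (hY : ∀ r, (∀ y ∈ Y, ¬ r.called w y) → g r = f r)
    (hfs : ∀ r, ∀ y ∈ Y, f (r ⊔ Row.single W w y) = f r) :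
    ∫⁻ r, g r ∂ρ ≤ ∫⁻ c, ∫⁻ b, ∫⁻ r, (if b = true ∧ c ∈ Y then g (r ⊔ Row.single W w c) else f r)
      ∂ρ ∂coin p ∂κ := by
  have hm : ∀ h : Row W V → ℝ≥0∞, Measurable h := fun h => measurable_of_countable h
  let d : V → Row W V → ℝ≥0∞ := fun c r =>
    if c ∈ Y then g (r ⊔ Row.single W w c) - f r else 0
  have h1 : ∀ r, g r ≤ f r + ∑ y, if y ∈ Y then
      {r : Row W V | r.called w y}.indicator (fun r => g r - f r) r else 0 := by
    intro r
    by_cases h : ∀ y ∈ Y, ¬ r.called w y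
    · rw [hY r h]
      exact le_self_add
    · push Not at h
      obtain ⟨y, hy, hc⟩ := h
      calc g r = f r + (g r - f r) := (add_tsub_cancel_of_le (hfg r)).symm
        _ ≤ _ := by
          gcongr
          refine le_trans ?_ (Finset.single_le_sum (fun _ _ => zero_le) (Finset.mem_univ y))
          rw [if_pos hy, Set.indicator_of_mem (show r ∈ {r : Row W V | r.called w y} from hc)]
  have h2 : ∫⁻ r, g r ∂ρ ≤ ∫⁻ r, f r ∂ρ + ∑ c, p * κ {c} * ∫⁻ r, d c r ∂ρ := by
    refine (lintegral_mono h1).trans ?_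
    rw [lintegral_add_left (hm f), lintegral_finsetSum _ fun _ _ => hm _]
    gcongr with c
    by_cases hc : c ∈ Y
    · simp only [hc, if_true, d]
      refine (hρ w c fun r => g r - f r).trans (le_of_eq ?_)
      congr 1
      exact lintegral_congr fun r => by rw [hfs r c hc]
    · simp [hc]
  have h3 : ∀ c, ∫⁻ r, (if c ∈ Y then g (r ⊔ Row.single W w c) else f r) ∂ρ =
      ∫⁻ r, f r ∂ρ + ∫⁻ r, d c r ∂ρ := by
    intro c
    rw [← lintegral_add_left (hm f)]
    refine lintegral_congr fun r => ?_
    by_cases hc : c ∈ Y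
    · simp only [hc, if_true, d]
      exact (add_tsub_cancel_of_le ((hfs r c hc).symm.trans_le (hfg _))).symm
    · simp [hc, d]
  refine h2.trans (le_of_eq ?_)
  have h4 : ∀ c, ∫⁻ b, ∫⁻ r, (if b = true ∧ c ∈ Y then g (r ⊔ Row.single W w c) else f r)
      ∂ρ ∂coin p = ∫⁻ r, f r ∂ρ + p * ∫⁻ r, d c r ∂ρ := by
    intro c
    rw [lintegral_coin]
    simp only [true_and, h3, Bool.false_eq_true, false_and, if_false]
    rw [mul_add, add_right_comm, ← add_mul, add_tsub_cancel_of_le hp, one_mul]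
  simp_rw [h4]
  rw [lintegral_fintype (μ := κ)]
  simp_rw [add_mul]
  rw [Finset.sum_add_distrib, ← Finset.mul_sum]
  have h5 : ∑ c, κ {c} = 1 := by
    rw [sum_measure_singleton]
    simp
  rw [h5, mul_one]
  congr 1
  exact Finset.sum_congr rfl fun c _ => by ring

namespace State

lemma lintegral_dataBefore_le {p : ℝ≥0∞} (hp : p ≤ 1) {κ : Measure V} [IsProbabilityMeasure κ]
    {ρ : Measure (Row W V)} [IsProbabilityMeasure ρ] (hρ : MeckeLaw p κ ρ) (σ : State V)
    (hσ : σ.Valid) (x : V) (φ : LevelData W V → ℝ≥0∞) (hφ : Monotone φ) :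
    ∫⁻ r, φ (σ.dataBefore x r) ∂ρ ≤ ∫⁻ q, φ (σ.dataAfter x q) ∂((κ.prod (coin p)).prod ρ) := by
  have : IsProbabilityMeasure (coin p) := isProbabilityMeasure_coin hp
  rw [lintegral_prod _ (measurable_of_countable _).aemeasurable,
    lintegral_prod _ (measurable_of_countable _).aemeasurable]
  classical
  by_cases hx : x ∈ σ.I
  -- For an active vertex all calls of the current window are revealed: on failure of the coin none
  -- remain and the vertex retires, on success the used call is added to a fresh row.
  · let f : Row W V → ℝ≥0∞ := fun r => φ (False, ⊥, r.after σ.w)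
    by_cases hA : x ∈ σ.A
    · let g : Row W V → ℝ≥0∞ := fun r => φ (False, r.called σ.w, r.after σ.w)
      have hg : ∀ r, φ (σ.dataBefore x r) = g r := by
        intro r
        simp [g, dataBefore, hx, hA]
      simp_rw [hg]
      refine (hρ.lintegral_le hp σ.w f g ?_ Set.univ ?_ ?_).trans ?_
      · exact fun r => hφ ⟨le_rfl, bot_le, le_rfl⟩
      · intro r hr
        have : r.called σ.w = ⊥ := by
          funext y
          exact eq_false (hr y trivial)
        simp only [f, g, this]
      · intro r y _
        simp only [f, Row.after_sup_single]
      · refine lintegral_mono fun c => lintegral_mono fun b => lintegral_mono fun r => ?_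
        cases b with
        | true =>
          simp only [Set.mem_univ, and_self, if_true, g, Row.after_sup_single]
          refine hφ ⟨fun h => h.elim, fun y hy => Or.inl ⟨hA, rfl, ?_⟩, le_rfl⟩
          exact Row.called_sup_single_imp hy
        | false =>
          simp only [Bool.false_eq_true, false_and, if_false, f]
          exact hφ ⟨fun h => h.elim, bot_le, le_rfl⟩
    · have hg : ∀ r, φ (σ.dataBefore x r) = f r := by
        intro r
        simp only [f, dataBefore, hx, hA, not_true, false_and, or_self, and_false]
        rfl
      simp_rw [hg]
      calc ∫⁻ r, f r ∂ρ = ∫⁻ c, ∫⁻ b, ∫⁻ r, f r ∂ρ ∂coin p ∂κ := by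
            simp only [lintegral_const, measure_univ, mul_one]
        _ ≤ _ := by
          refine lintegral_mono fun c => lintegral_mono fun b => lintegral_mono fun r => ?_
          exact hφ ⟨fun h => h.elim, bot_le, le_rfl⟩
  · have hA : x ∉ σ.A := fun h => hx (hσ.2 h)
    let f : Row W V → ℝ≥0∞ := fun r =>
      φ (False, fun y => r.called σ.w y ∧ y ∉ σ.I, r.after σ.w)
    let g : Row W V → ℝ≥0∞ := fun r => φ (∃ y ∈ σ.D, r.called σ.w y,
      fun y => r.called σ.w y ∧ y ∉ σ.I, r.after σ.w)
    have hg : ∀ r, φ (σ.dataBefore x r) = g r := by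
      intro r
      simp [g, dataBefore, hx, hA]
    have hD : ∀ y ∈ σ.D, y ∈ σ.I := fun y hy => hσ.2 (hσ.1 hy)
    -- For an uninformed vertex only the calls to fresh vertices are revealed. Fresh vertices are
    -- informed, so adding such a call leaves the calls to uninformed vertices as they were.
    have hs : ∀ r : Row W V, ∀ y ∈ σ.D, (fun z => (r ⊔ Row.single W σ.w y).called σ.w z ∧ z ∉ σ.I) =
        fun z => r.called σ.w z ∧ z ∉ σ.I := by
      intro r y hy
      funext z
      refine propext ⟨fun ⟨h1, h2⟩ => ?_, fun ⟨⟨h, h1⟩, h2⟩ => ⟨⟨h, Or.inl h1⟩, h2⟩⟩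
      rcases Row.called_sup_single_imp h1 with h | rfl
      · exact ⟨h, h2⟩
      · exact absurd (hD _ hy) h2
    simp_rw [hg]
    refine (hρ.lintegral_le hp σ.w f g ?_ σ.D ?_ ?_).trans ?_
    · exact fun r => hφ ⟨fun h => h.elim, le_rfl, le_rfl⟩
    · intro r hr
      have : (∃ y ∈ σ.D, r.called σ.w y) = False := by
        simpa using hr
      simp only [f, g, this]
    · intro r y hy
      simp only [f, Row.after_sup_single, hs r y hy]
    · refine lintegral_mono fun c => lintegral_mono fun b => lintegral_mono fun r => ?_
      split_ifs with h
      · simp only [g, Row.after_sup_single, hs r c h.2]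
        exact hφ ⟨fun _ => ⟨hx, h⟩, fun y hy => Or.inr ⟨hy.1, hx, hy.2⟩, le_rfl⟩
      · exact hφ ⟨fun h => h.elim, fun y hy => Or.inr ⟨hy.1, hx, hy.2⟩, le_rfl⟩

/-- The probability that everyone is informed at the end does not decrease when a level of the
exploration is replaced by a level with fresh calls. -/
lemma measure_final_le_step {p : ℝ≥0∞} (hp : p ≤ 1) (κ : V → Measure V)
    [∀ x, IsProbabilityMeasure (κ x)] (ρ : V → Measure (Row W V))
    [∀ x, IsProbabilityMeasure (ρ x)] (hρ : ∀ x, MeckeLaw p (κ x) (ρ x)) (σ : State V)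
    (hσ : σ.Valid) :
    Measure.pi ρ {R | σ.final R = Set.univ} ≤
      ∫⁻ z, Measure.pi ρ {R | (σ.step z).final R = Set.univ}
        ∂Measure.pi fun x => (κ x).prod (coin p) := by
  have : IsProbabilityMeasure (coin p) := isProbabilityMeasure_coin hp
  have hconst : ∀ q : ℝ≥0∞, ∫⁻ _, q ∂(Measure.pi fun x => (κ x).prod (coin p)) = q := by simp
  rcases σ with ⟨_ | k, w, I, A, D⟩
  · simp [State.step]
  by_cases hA : A = ∅
  · subst hA
    rw [← hconst (Measure.pi ρ _)]
    refine lintegral_mono fun z => measure_mono fun R hR => ?_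
    exact Set.univ_subset_iff.1
      ((Eq.symm hR).subset.trans (final_step_of_empty k w I D hσ.1 z R))
  set σ := State.mk (k + 1) w I A D with hσ'
  classical
  let Φ : (V → LevelData W V) → ℝ≥0∞ := {d | finalOfData k w I d = Set.univ}.indicator 1
  have hΦ : Monotone Φ := by
    intro d d' h
    by_cases hd : finalOfData k w I d = Set.univ
    · have hd' : finalOfData k w I d' = Set.univ :=
        Set.univ_subset_iff.1 (hd.symm.subset.trans (finalOfData_mono k w I h))
      simp [Φ, hd, hd']
    · simp [Φ, hd]
  have hm : ∀ {α : Type _} [MeasurableSpace α] [Countable α] [MeasurableSingletonClass α]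
      (f : α → ℝ≥0∞), Measurable f := fun f => measurable_of_countable f
  have hb : ∀ x, Measurable (σ.dataBefore (W := W) x) := fun x => measurable_of_countable _
  have ha : ∀ x, Measurable (σ.dataAfter (W := W) x) := fun x => measurable_of_countable _
  have hpb : ∀ x, IsProbabilityMeasure ((ρ x).map (σ.dataBefore x)) := fun x =>
    Measure.isProbabilityMeasure_map (hb x).aemeasurable
  have hpa : ∀ x, IsProbabilityMeasure
      ((((κ x).prod (coin p)).prod (ρ x)).map (σ.dataAfter x)) := fun x =>
    Measure.isProbabilityMeasure_map (ha x).aemeasurable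
  have hset : ∀ (s : Set (V → Row W V)), Measure.pi ρ s = ∫⁻ R, s.indicator 1 R ∂Measure.pi ρ :=
    fun s => (lintegral_indicator_one s.to_countable.measurableSet).symm
  calc Measure.pi ρ {R | σ.final R = Set.univ}
      ≤ ∫⁻ R, Φ (fun x => σ.dataBefore x (R x)) ∂Measure.pi ρ := by
        rw [hset]
        refine lintegral_mono fun R => ?_
        by_cases hR : σ.final R = Set.univ
        · have : finalOfData k w I (fun x => σ.dataBefore x (R x)) = Set.univ :=
            Set.univ_subset_iff.1 (hR.symm.subset.trans (final_subset_finalOfData k w I A D R))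
          simp [Φ, this, hR]
        · simp [hR]
    _ = ∫⁻ d, Φ d ∂Measure.pi fun x => (ρ x).map (σ.dataBefore x) := by
        rw [← Measure.pi_map_pi fun x => (hb x).aemeasurable,
          lintegral_map (hm _) (measurable_of_countable _)]
    _ ≤ ∫⁻ d, Φ d ∂Measure.pi fun x =>
          (((κ x).prod (coin p)).prod (ρ x)).map (σ.dataAfter x) := by
        refine lintegral_pi_le_of_forall_monotone _ _ (fun x φ hφ => ?_) hΦ
        rw [lintegral_map (hm _) (hb x), lintegral_map (hm _) (ha x)]
        exact lintegral_dataBefore_le hp (hρ x) σ hσ x φ hφ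
    _ = ∫⁻ q, Φ (fun x => σ.dataAfter x (q x))
          ∂Measure.pi fun x => ((κ x).prod (coin p)).prod (ρ x) := by
        rw [← Measure.pi_map_pi fun x => (ha x).aemeasurable,
          lintegral_map (hm _) (measurable_of_countable _)]
    _ = ∫⁻ z, ∫⁻ R, Φ (fun x => σ.dataAfter x (z x, R x)) ∂Measure.pi ρ
          ∂Measure.pi fun x => (κ x).prod (coin p) := by
        rw [← lintegral_prod (fun q : (V → V × Bool) × (V → Row W V) =>
          Φ (fun x => σ.dataAfter x (q.1 x, q.2 x))) (hm _).aemeasurable,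
          ← (measurePreserving_arrowProdEquivProdArrow (V × Bool) (Row W V) V
            (fun x => (κ x).prod (coin p)) ρ).lintegral_comp (hm _)]
        rfl
    _ ≤ _ := by
        refine lintegral_mono fun z => ?_
        rw [hset]
        refine lintegral_mono fun R => ?_
        by_cases hR : finalOfData k w I (fun x => σ.dataAfter x (z x, R x)) = Set.univ
        · have : (σ.step z).final R = Set.univ := Set.univ_subset_iff.1
            (hR.symm.subset.trans (finalOfData_subset_final_step k w I A D hA hσ.2 z R))
          simp [Φ, this, hR]
        · simp [Φ, hR]

end State

end

/-! ### Chains of transmissions and the number of levels: deterministic part. -/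

namespace State

section Deterministic

variable {V : Type*}

/-- The state of the exploration after some levels that use the calls `θ`. -/
noncomputable def explore (σ : State V) (θ : ℕ → V → V × Bool) : ℕ → State V
  | 0 => σ
  | l + 1 => (explore σ θ l).step (θ l)

lemma explore_add (σ : State V) (θ : ℕ → V → V × Bool) (a b : ℕ) :
    σ.explore θ (a + b) = (σ.explore θ a).explore (fun n => θ (n + a)) b := by
  induction b with
  | zero => rfl
  | succ b ih =>
    rw [← add_assoc, explore, ih, explore, add_comm a b]

lemma explore_succ' (σ : State V) (θ : ℕ → V → V × Bool) (b : ℕ) :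
    σ.explore θ (b + 1) = (σ.step (θ 0)).explore (fun n => θ (n + 1)) b := by
  rw [add_comm, explore_add]
  rfl

lemma Valid.explore {σ : State V} (h : σ.Valid) (θ : ℕ → V → V × Bool) (l : ℕ) :
    (σ.explore θ l).Valid := by
  induction l with
  | zero => exact h
  | succ l ih => exact ih.step _

lemma step_k_le (σ : State V) (z : V → V × Bool) : (σ.step z).k ≤ σ.k := by
  rcases σ with ⟨_ | k, w, I, A, D⟩
  · exact le_rfl
  · by_cases hA : A = ∅ <;> simp [step, hA]

lemma subset_step_I (σ : State V) (z : V → V × Bool) : σ.I ⊆ (σ.step z).I := by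
  rcases σ with ⟨_ | k, w, I, A, D⟩
  · exact subset_rfl
  · by_cases hA : A = ∅
    · simp [step, hA]
    · simp only [step, hA, if_false]
      exact Set.subset_union_left

lemma explore_k_le (σ : State V) (θ : ℕ → V → V × Bool) (l : ℕ) : (σ.explore θ l).k ≤ σ.k := by
  induction l with
  | zero => exact le_rfl
  | succ l ih => exact (step_k_le _ _).trans ih

lemma subset_explore_I (σ : State V) (θ : ℕ → V → V × Bool) (l : ℕ) :
    σ.I ⊆ (σ.explore θ l).I := by
  induction l with
  | zero => exact subset_rfl
  | succ l ih => exact ih.trans (subset_step_I _ _)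

lemma step_I_subset {σ : State V} (h : σ.Valid) (z : V → V × Bool) {S : Set V} (hS : σ.I ⊆ S) :
    (σ.step z).I ⊆ {v | v ∈ S ∨ (∃ x ∈ S, (z x).1 = v) ∨ (z v).1 ∈ S} := by
  rcases σ with ⟨_ | k, w, I, A, D⟩
  · exact fun v hv => Or.inl (hS hv)
  · by_cases hA : A = ∅
    · simp only [step, hA, if_true]
      exact fun v hv => Or.inl (hS hv)
    · simp only [step, hA, if_false]
      rintro v (hv | ⟨x, hx, -, h2⟩ | ⟨-, -, hv⟩)
      · exact Or.inl (hS hv)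
      · exact Or.inr (Or.inl ⟨x, hS (h.2 hx), h2⟩)
      · exact Or.inr (Or.inr (hS (h.2 (h.1 hv))))

/-- The exploration never overtakes the synchronous protocol with the same calls. -/
lemma explore_I_subset_syncInformed {σ : State V} (h : σ.Valid) (θ : ℕ → V → V × Bool) (s : V)
    (hs : σ.I ⊆ {s}) (l : ℕ) :
    (σ.explore θ l).I ⊆ syncInformed (fun q => (θ q.1 q.2).1) s l := by
  induction l with
  | zero => exact hs
  | succ l ih => exact step_I_subset (h.explore θ l) (θ l) ih

/-- One step of a chain of transmissions: `x` stays active, or calls a vertex outside `B`, or is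
called by `y`. -/
def ChainStep (B : Set V) (z : V → V × Bool) (x y : V) : Prop :=
  (x = y ∧ (z x).2 = true) ∨ ((z x).1 = y ∧ (z x).2 = true ∧ y ∉ B) ∨
    ((z y).1 = x ∧ (z y).2 = true)

/-- There is a chain of transmissions through the first `L` levels that starts at `x`. -/
def Chain (B : Set V) : ℕ → (ℕ → V → V × Bool) → V → Prop
  | 0, _, _ => True
  | L + 1, θ, x => ∃ y, ChainStep B (θ 0) x y ∧ Chain B L (fun n => θ (n + 1)) y

/-- An active vertex after a step was active before, was pushed to by an active vertex, or pulled
from a fresh and hence active one. A push into `B` cannot have informed it, because no vertex of `B`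
becomes informed during these levels. -/
lemma exists_chain (B : Set V) (L : ℕ) : ∀ (σ : State V) (θ : ℕ → V → V × Bool), σ.Valid →
    σ.k ≠ 0 → (σ.explore θ L).k = σ.k → (∀ v ∈ B, v ∈ (σ.explore θ L).I → v ∈ σ.I) →
    (σ.explore θ L).A.Nonempty → ∃ x ∈ σ.A, Chain B L θ x := by
  induction L with
  | zero => exact fun σ θ _ _ _ _ ⟨x, hx⟩ => ⟨x, hx, trivial⟩
  | succ L ih =>
    intro σ θ hσ h0 hk hB hne
    rw [explore_succ'] at hk hB hne
    have hk1 : (σ.step (θ 0)).k = σ.k :=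
      le_antisymm (step_k_le _ _) (hk ▸ explore_k_le _ _ _)
    obtain ⟨y, hy, hc⟩ := ih _ _ (hσ.step _) (hk1 ▸ h0) (hk.trans hk1.symm)
      (fun v hv hv' => subset_step_I _ _ (hB v hv hv')) hne
    have hB' : ∀ v ∈ B, v ∈ (σ.step (θ 0)).I → v ∈ σ.I := fun v hv h =>
      hB v hv (subset_explore_I _ _ _ h)
    rcases σ with ⟨_ | k, w, I, A, D⟩
    · exact absurd rfl h0
    · by_cases hA : A = ∅
      · simp [step, hA] at hk1
      · simp only [step, hA, if_false] at hy hB'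
        rcases hy with ⟨h1, h2⟩ | ⟨h1 | ⟨x, hx, h2, h3⟩ | ⟨_, h2, h3⟩, h4⟩
        · exact ⟨y, h1, y, Or.inl ⟨rfl, h2⟩, hc⟩
        · exact absurd h1 h4
        · exact ⟨x, hx, y, Or.inr (Or.inl ⟨h3, h2, fun hyB =>
            h4 (hB' y hyB (Or.inr (Or.inl ⟨x, hx, h2, h3⟩)))⟩), hc⟩
        · exact ⟨_, hσ.1 h3, y, Or.inr (Or.inr ⟨rfl, h2⟩), hc⟩

/-- The number of windows left plus the number of uninformed vertices of `B`. -/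
noncomputable def potential (B : Set V) (σ : State V) : ℕ := σ.k + (B \ σ.I).ncard

/-- If neither a window ends nor a vertex of `B` is informed, some vertex is still active after `L`
levels, as otherwise level `L + 1` would close the window. Tracing it back gives a chain of length
`L`. -/
lemma potential_explore_lt [Finite V] (B : Set V) (L : ℕ) (σ : State V)
    (θ : ℕ → V → V × Bool) (hσ : σ.Valid) (hc : ∀ x, ¬ Chain B L θ x) :
    (σ.explore θ (L + 1)).k = 0 ∨
      (σ.explore θ (L + 1)).potential B + 1 ≤ σ.potential B := by
  by_contra! h
  obtain ⟨h0, hp⟩ := h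
  have hk := σ.explore_k_le θ (L + 1)
  have hI := σ.subset_explore_I θ (L + 1)
  have hsub : B \ (σ.explore θ (L + 1)).I ⊆ B \ σ.I := Set.sdiff_subset_sdiff_right hI
  have hcard := Set.ncard_le_ncard hsub (Set.toFinite _)
  simp only [potential] at hp
  have hk' : (σ.explore θ (L + 1)).k = σ.k := by omega
  have heq : B \ (σ.explore θ (L + 1)).I = B \ σ.I :=
    Set.eq_of_subset_of_ncard_le hsub (by omega) (Set.toFinite _)
  have hkL : (σ.explore θ L).k = σ.k :=
    le_antisymm (σ.explore_k_le θ L) (hk' ▸ step_k_le _ _)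
  have hne : (σ.explore θ L).A.Nonempty := by
    rw [explore] at hk'
    generalize σ.explore θ L = τ at hk' hkL
    rcases τ with ⟨_ | k, w, I, A, D⟩
    · have h1 : σ.k = 0 := hkL.symm
      omega
    · by_contra hA
      rw [Set.not_nonempty_iff_eq_empty] at hA
      simp only at hA
      simp only [step, hA, if_true] at hk' hkL
      omega
  obtain ⟨x, -, hx⟩ := exists_chain B L σ θ hσ (by omega) hkL (fun v hv hv' => by
    by_contra hvI
    have : v ∈ B \ (σ.explore θ (L + 1)).I := heq ▸ ⟨hv, hvI⟩
    exact this.2 (subset_step_I _ _ hv')) hne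
  exact hc x hx

lemma explore_k_eq_zero [Finite V] (B : Set V) (L : ℕ) (σ : State V) (θ : ℕ → V → V × Bool)
    (hσ : σ.Valid) (m : ℕ) (hm : σ.potential B < m)
    (hc : ∀ i < m, ∀ x, ¬ Chain B L (fun n => θ (n + i * (L + 1))) x) :
    (σ.explore θ (m * (L + 1))).k = 0 := by
  have key : ∀ j ≤ m, (σ.explore θ (j * (L + 1))).k = 0 ∨
      (σ.explore θ (j * (L + 1))).potential B + j ≤ σ.potential B := by
    intro j
    induction j with
    | zero =>
      intro _
      right
      simp [explore]
    | succ j ih =>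
      intro hj
      rw [add_mul, one_mul, explore_add]
      rcases ih (by omega) with h | h
      · left
        have := explore_k_le (σ.explore θ (j * (L + 1))) (fun n => θ (n + j * (L + 1))) (L + 1)
        omega
      · rcases potential_explore_lt B L (σ.explore θ (j * (L + 1)))
          (fun n => θ (n + j * (L + 1))) (hσ.explore θ _) (hc j (by omega)) with h' | h'
        · exact Or.inl h'
        · right
          omega
  rcases key m le_rfl with h | h
  · exact h
  · omega

end Deterministic

/-! ### Chains of transmissions and the number of levels: probabilities. -/

section Probability

variable {V : Type*} [Fintype V] [MeasurableSpace V] [DiscreteMeasurableSpace V]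

lemma measurable_explore (σ : State V) (l : ℕ) :
    Measurable fun θ : ℕ → V → V × Bool => σ.explore θ l := by
  induction l with
  | zero => exact measurable_const
  | succ l ih =>
    have h : Measurable fun q : State V × (V → V × Bool) => q.1.step q.2 :=
      measurable_from_prod_countable_left fun z => measurable_from_top
    exact h.comp (ih.prodMk (measurable_pi_apply l))

lemma measurableSet_chain (B : Set V) (L : ℕ) : ∀ x : V,
    MeasurableSet {θ : ℕ → V → V × Bool | Chain B L θ x} := by
  induction L with
  | zero => exact fun x => by simp [Chain]
  | succ L ih =>
    intro x
    have : {θ : ℕ → V → V × Bool | Chain B (L + 1) θ x} =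
        ⋃ y, (fun θ : ℕ → V → V × Bool => θ 0) ⁻¹' {z | ChainStep B z x y} ∩
          (fun θ n => θ (n + 1)) ⁻¹' {θ | Chain B L θ y} := by
      ext θ
      simp [Chain]
    rw [this]
    refine MeasurableSet.iUnion fun y => MeasurableSet.inter ?_ ?_
    · exact (measurable_pi_apply 0) (Set.to_countable _).measurableSet
    · exact (by fun_prop : Measurable fun (θ : ℕ → V → V × Bool) n => θ (n + 1)) (ih y)

variable {p : ℝ≥0∞} (κ : V → Measure V) [∀ x, IsProbabilityMeasure (κ x)]

/-- The law of the calls and coins of one level. -/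
noncomputable def levelLaw (p : ℝ≥0∞) (κ : V → Measure V) : Measure (V → V × Bool) :=
  Measure.pi fun x => (κ x).prod (coin p)

lemma isProbabilityMeasure_levelLaw {V : Type*} [Fintype V] [MeasurableSpace V] {p : ℝ≥0∞}
    (κ : V → Measure V) [∀ x, IsProbabilityMeasure (κ x)] (hp : p ≤ 1) : IsProbabilityMeasure (levelLaw p κ) := by
  have : IsProbabilityMeasure (coin p) := isProbabilityMeasure_coin hp
  unfold levelLaw
  infer_instance

lemma levelLaw_call (hp : p ≤ 1) (x y : V) :
    levelLaw p κ {z | (z x).1 = y ∧ (z x).2 = true} = κ x {y} * p := by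
  have : IsProbabilityMeasure (coin p) := isProbabilityMeasure_coin hp
  have h := (measurePreserving_eval (fun x => (κ x).prod (coin p)) x).measure_preimage
    (s := {y} ×ˢ {true}) (Set.to_countable _).measurableSet.nullMeasurableSet
  rw [Measure.prod_prod] at h
  have hc : coin p {true} = p := by simp [coin]
  rw [hc] at h
  rw [← h]
  congr 1

lemma levelLaw_coin (hp : p ≤ 1) (x : V) :
    levelLaw p κ {z | (z x).2 = true} = p := by
  have : IsProbabilityMeasure (coin p) := isProbabilityMeasure_coin hp
  have h := (measurePreserving_eval (fun x => (κ x).prod (coin p)) x).measure_preimage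
    (s := Set.univ ×ˢ {true}) (Set.to_countable _).measurableSet.nullMeasurableSet
  rw [Measure.prod_prod] at h
  have hc : coin p {true} = p := by simp [coin]
  rw [hc, measure_univ, one_mul] at h
  conv_rhs => rw [← h]
  congr 1
  ext z
  simp

variable (ψ : V → ℝ≥0∞) (B : Set V)

open Classical in
/-- The expected number of chain steps from `x`, weighted by the potential `ψ` of the end point,
is at most half the potential of `x`. -/
def Contracts (p : ℝ≥0∞) (κ : V → Measure V) (ψ : V → ℝ≥0∞) (B : Set V) : Prop :=
  ∀ x, p * (ψ x + ∑ y, (if y ∈ B then 0 else κ x {y} * ψ y) + ∑ y, κ y {x} * ψ y) ≤ 2⁻¹ * ψ x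

variable {ψ B}

/-- First moment method: condition on the first level, apply a union bound over the next vertex of
the chain, and let `Contracts` supply a factor `1/2` per level. The bound `1 ≤ ψ` starts the
induction. -/
lemma measure_chain_le (hp : p ≤ 1) (h1 : ∀ x, 1 ≤ ψ x) (hψ : Contracts p κ ψ B) (L : ℕ) :
    ∀ x, Measure.infinitePi (fun _ : ℕ => levelLaw p κ) {θ | Chain B L θ x} ≤ 2⁻¹ ^ L * ψ x := by
  classical
  have := isProbabilityMeasure_levelLaw κ hp
  induction L with
  | zero => exact fun x => by simpa [Chain] using h1 x
  | succ L ih =>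
    intro x
    have hm : ∀ f : (V → V × Bool) → ℝ≥0∞, Measurable f := fun f => measurable_of_countable f
    have hS : ∀ y, levelLaw p κ {z | ChainStep B z x y} ≤ (if x = y then p else 0) +
        (if y ∈ B then 0 else κ x {y} * p) + κ y {x} * p := by
      intro y
      have hsub : {z : V → V × Bool | ChainStep B z x y} ⊆
          {z | x = y ∧ (z x).2 = true} ∪ {z | y ∉ B ∧ (z x).1 = y ∧ (z x).2 = true} ∪
            {z | (z y).1 = x ∧ (z y).2 = true} := by
        rintro z (h | ⟨h2, h3, h4⟩ | h)
        · exact Or.inl (Or.inl h)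
        · exact Or.inl (Or.inr ⟨h4, h2, h3⟩)
        · exact Or.inr h
      refine (measure_mono hsub).trans ((measure_union_le _ _).trans ?_)
      refine add_le_add ((measure_union_le _ _).trans (add_le_add ?_ ?_))
        (levelLaw_call κ hp y x).le
      · split_ifs with h
        · simp only [h, true_and]
          exact (levelLaw_coin κ hp y).le
        · simp [h]
      · split_ifs with h
        · simp [h]
        · simp only [h, not_false_eq_true, true_and]
          exact (levelLaw_call κ hp x y).le
    calc Measure.infinitePi (fun _ : ℕ => levelLaw p κ) {θ | Chain B (L + 1) θ x}
        = ∫⁻ z, Measure.infinitePi (fun _ : ℕ => levelLaw p κ)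
            {θ | ∃ y, ChainStep B z x y ∧ Chain B L θ y} ∂levelLaw p κ := by
          rw [← lintegral_indicator_one (measurableSet_chain B (L + 1) x),
            lintegral_infinitePi_nat _ (measurable_one.indicator (measurableSet_chain B (L + 1) x))]
          refine lintegral_congr fun z => ?_
          have : {θ : ℕ → V → V × Bool | ∃ y, ChainStep B z x y ∧ Chain B L θ y} =
              ⋃ y, {θ | ChainStep B z x y ∧ Chain B L θ y} := by
            ext θ; simp
          have hmeas : MeasurableSet
              {θ : ℕ → V → V × Bool | ∃ y, ChainStep B z x y ∧ Chain B L θ y} := by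
            rw [this]
            refine MeasurableSet.iUnion fun y => ?_
            by_cases h : ChainStep B z x y
            · simpa [h] using measurableSet_chain B L y
            · simp [h]
          rw [← lintegral_indicator_one hmeas]
          rfl
      _ ≤ ∫⁻ z, ∑ y, {z | ChainStep B z x y}.indicator (fun _ => 2⁻¹ ^ L * ψ y) z
            ∂levelLaw p κ := by
          refine lintegral_mono fun z => ?_
          have : {θ : ℕ → V → V × Bool | ∃ y, ChainStep B z x y ∧ Chain B L θ y} =
              ⋃ y, {θ | ChainStep B z x y ∧ Chain B L θ y} := by
            ext θ; simp
          rw [this]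
          refine (measure_iUnion_fintype_le _ _).trans (Finset.sum_le_sum fun y _ => ?_)
          by_cases h : ChainStep B z x y
          · simpa [h] using ih y
          · simp [h]
      _ = ∑ y, 2⁻¹ ^ L * ψ y * levelLaw p κ {z | ChainStep B z x y} := by
          rw [lintegral_finsetSum _ fun _ _ => hm _]
          refine Finset.sum_congr rfl fun y _ => ?_
          rw [lintegral_indicator_const (Set.to_countable _).measurableSet]
      _ ≤ ∑ y, 2⁻¹ ^ L * ψ y * ((if x = y then p else 0) +
            (if y ∈ B then 0 else κ x {y} * p) + κ y {x} * p) := by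
          gcongr with y
          exact hS y
      _ = 2⁻¹ ^ L * (p * (ψ x + ∑ y, (if y ∈ B then 0 else κ x {y} * ψ y) +
            ∑ y, κ y {x} * ψ y)) := by
          simp only [mul_add, Finset.sum_add_distrib, Finset.mul_sum]
          refine congrArg₂ _ (congrArg₂ _ ?_ ?_) ?_
          · simp [mul_assoc, mul_comm]
          · refine Finset.sum_congr rfl fun y _ => ?_
            split_ifs
            · simp
            · ring
          · refine Finset.sum_congr rfl fun y _ => ?_
            ring
      _ ≤ 2⁻¹ ^ L * (2⁻¹ * ψ x) := by
          exact mul_le_mul' le_rfl (hψ x)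
      _ = 2⁻¹ ^ (L + 1) * ψ x := by ring

/-- Union bound over the `m` blocks of `L + 1` levels and over the first vertex of the chain. Blocks
are shifts of one another and have the same law. -/
lemma measure_explore_k_ne_zero_le (hp : p ≤ 1) (h1 : ∀ x, 1 ≤ ψ x) (hψ : Contracts p κ ψ B)
    (L m : ℕ) (σ : State V) (hσ : σ.Valid) (hm : σ.potential B < m) :
    Measure.infinitePi (fun _ : ℕ => levelLaw p κ) {θ | (σ.explore θ (m * (L + 1))).k ≠ 0} ≤
      m * (2⁻¹ ^ L * ∑ x, ψ x) := by
  have := isProbabilityMeasure_levelLaw κ hp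
  have hsub : {θ : ℕ → V → V × Bool | (σ.explore θ (m * (L + 1))).k ≠ 0} ⊆
      ⋃ i ∈ Finset.range m, ⋃ x, (fun θ n => θ (n + i * (L + 1))) ⁻¹' {θ | Chain B L θ x} := by
    intro θ hθ
    by_contra h
    simp only [Set.mem_iUnion, Set.mem_preimage, Set.mem_ofPred_eq, not_exists,
      Finset.mem_range] at h
    exact hθ (explore_k_eq_zero B L σ θ hσ m hm h)
  refine (measure_mono hsub).trans ((measure_biUnion_finset_le _ _).trans ?_)
  calc _ ≤ ∑ i ∈ Finset.range m, (2⁻¹ ^ L * ∑ x, ψ x : ℝ≥0∞) := by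
        refine Finset.sum_le_sum fun i _ => (measure_iUnion_fintype_le _ _).trans ?_
        rw [Finset.mul_sum]
        refine Finset.sum_le_sum fun x _ => ?_
        rw [← Measure.map_apply (by fun_prop) (measurableSet_chain B L x),
          map_shift_infinitePi]
        exact measure_chain_le κ hp h1 hψ L x
    _ = _ := by simp

variable {W : ℕ}

lemma measure_final_le_explore (hp : p ≤ 1) (ρ : V → Measure (Row W V))
    [∀ x, IsProbabilityMeasure (ρ x)] (hρ : ∀ x, MeckeLaw p (κ x) (ρ x)) (l : ℕ) :
    ∀ σ : State V, σ.Valid → Measure.pi ρ {R | σ.final R = Set.univ} ≤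
      ∫⁻ θ, Measure.pi ρ {R | (σ.explore θ l).final R = Set.univ}
        ∂Measure.infinitePi fun _ : ℕ => levelLaw p κ := by
  have := isProbabilityMeasure_levelLaw κ hp
  induction l with
  | zero => exact fun σ _ => by simp [explore]
  | succ l ih =>
    intro σ hσ
    have hm : Measurable fun θ : ℕ → V → V × Bool =>
        Measure.pi ρ {R | (σ.explore θ (l + 1)).final R = Set.univ} :=
      (measurable_from_top (f := fun τ : State V =>
        Measure.pi ρ {R | τ.final R = Set.univ})).comp (measurable_explore σ (l + 1))
    rw [lintegral_infinitePi_nat _ hm]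
    refine (measure_final_le_step hp κ ρ hρ σ hσ).trans (lintegral_mono fun z => ?_)
    simp_rw [explore_succ']
    exact ih _ (hσ.step z)

/-- Comparison of the windows with the synchronous protocol. -/
lemma measure_windows_le (hp : p ≤ 1) (ρ : V → Measure (Row W V))
    [∀ x, IsProbabilityMeasure (ρ x)] (hρ : ∀ x, MeckeLaw p (κ x) (ρ x))
    (h1 : ∀ x, 1 ≤ ψ x) (hψ : Contracts p κ ψ B) (L m k : ℕ) (hm : k + B.ncard < m) (s : V) :
    Measure.pi ρ {R | windows (fun i x y => (R x).called i y) k 0 {s} = Set.univ} ≤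
      Measure.infinitePi (fun _ : ℕ => levelLaw p κ)
        {θ | ∀ v, v ∈ syncInformed (fun q => (θ q.1 q.2).1) s (m * (L + 1))} +
      m * (2⁻¹ ^ L * ∑ x, ψ x) := by
  have := isProbabilityMeasure_levelLaw κ hp
  set σ : State V := ⟨k, 0, {s}, {s}, {s}⟩ with hσdef
  have hσ : σ.Valid := ⟨subset_rfl, subset_rfl⟩
  have hpot : σ.potential B < m := by
    refine lt_of_le_of_lt ?_ hm
    exact Nat.add_le_add_left (Set.ncard_le_ncard Set.sdiff_subset (Set.toFinite _)) _
  have h0 : ∀ R : V → Row W V,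
      windows (fun i x y => (R x).called i y) k 0 {s} ⊆ σ.final R := by
    intro R
    rw [hσdef]
    cases k with
    | zero => exact subset_rfl
    | succ k =>
      refine windows_mono k 1 (fun _ _ _ _ h => h) fun v hv => ?_
      refine Reach.mono (fun x y hxy => ⟨hxy, ?_⟩) subset_rfl hv
      by_cases hx : x ∈ ({s} : Set V)
      · exact Or.inl hx
      · exact Or.inr ⟨hx, fun h => h⟩
  calc _ ≤ Measure.pi ρ {R | σ.final R = Set.univ} := by
        refine measure_mono fun R hR => ?_
        exact Set.univ_subset_iff.1 ((Eq.symm hR).subset.trans (h0 R))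
    _ ≤ ∫⁻ θ, Measure.pi ρ {R | (σ.explore θ (m * (L + 1))).final R = Set.univ}
        ∂Measure.infinitePi fun _ : ℕ => levelLaw p κ :=
        measure_final_le_explore κ hp ρ hρ _ σ hσ
    -- Once no window is left, `final` is the informed set and no longer depends on the rows, so the
    -- inner probability is `0` unless that set is everything.
    _ ≤ ∫⁻ θ, ((fun θ => σ.explore θ (m * (L + 1))) ⁻¹' {τ | τ.k = 0 → τ.I = Set.univ}).indicator
          1 θ ∂Measure.infinitePi fun _ : ℕ => levelLaw p κ := by
        refine lintegral_mono fun θ => ?_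
        by_cases h : (σ.explore θ (m * (L + 1))).k = 0 → (σ.explore θ (m * (L + 1))).I = Set.univ
        · rw [Set.indicator_of_mem (show θ ∈ (fun θ => σ.explore θ (m * (L + 1))) ⁻¹'
            {τ | τ.k = 0 → τ.I = Set.univ} from h)]
          exact prob_le_one
        · push Not at h
          have : ∀ R : V → Row W V, (σ.explore θ (m * (L + 1))).final R ≠ Set.univ := by
            intro R
            simp only [final, h.1]
            exact h.2
          simp [this]
    _ = Measure.infinitePi (fun _ : ℕ => levelLaw p κ)
          ((fun θ => σ.explore θ (m * (L + 1))) ⁻¹' {τ | τ.k = 0 → τ.I = Set.univ}) :=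
        lintegral_indicator_one (measurable_explore σ _ trivial)
    _ ≤ Measure.infinitePi (fun _ : ℕ => levelLaw p κ)
        ({θ | ∀ v, v ∈ syncInformed (fun q => (θ q.1 q.2).1) s (m * (L + 1))} ∪
          {θ | (σ.explore θ (m * (L + 1))).k ≠ 0}) := by
        refine measure_mono fun θ hθ => ?_
        by_cases h : (σ.explore θ (m * (L + 1))).k = 0
        · left
          intro v
          have := explore_I_subset_syncInformed hσ θ s subset_rfl (m * (L + 1))
          exact this ((hθ h).symm.subset trivial)
        · exact Or.inr h
    _ ≤ _ := (measure_union_le _ _).trans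
        (add_le_add_right (measure_explore_k_ne_zero_le κ hp h1 hψ L m σ hσ hpot) _)

end Probability

end State

/-! ### The weight `ψ` and the exceptional set `B`. -/

section Potential

variable {V : Type*} [Fintype V] [MeasurableSpace V]

/-- The expected number of chains of `a` pulls that start at `x`. -/
noncomputable def pullCount (κ : V → Measure V) : ℕ → V → ℝ≥0∞
  | 0, _ => 1
  | a + 1, x => ∑ y, κ y {x} * pullCount κ a y

variable [DiscreteMeasurableSpace V] (κ : V → Measure V) [∀ x, IsProbabilityMeasure (κ x)]

/-- Each vertex makes one call, so pulls only redistribute mass: a single `pullCount` may be large,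
but the average stays `1`. -/
lemma sum_pullCount (a : ℕ) : ∑ x, pullCount κ a x = Fintype.card V := by
  induction a with
  | zero => simp [pullCount]
  | succ a ih =>
    simp only [pullCount]
    rw [Finset.sum_comm, ← ih]
    refine Finset.sum_congr rfl fun y _ => ?_
    rw [← Finset.sum_mul, sum_measure_singleton]
    simp

lemma exists_contracts {p : ℝ≥0∞} (hp : 12 * p ≤ 1) :
    ∃ (ψ : V → ℝ≥0∞) (B : Set V), (∀ x, 1 ≤ ψ x) ∧ State.Contracts p κ ψ B ∧
      ∑ x, ψ x ≤ 2 * Fintype.card V ∧ (B.ncard : ℝ≥0∞) ≤ 144 * p ^ 2 * Fintype.card V := by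
  classical
  -- With `l = 6 p`, each of the three terms of `Contracts` times `l` is at most `ψ x`. Three terms
  -- over the factor `6` leave `1/2`.
  set l : ℝ≥0∞ := 6 * p with hl
  have hl2 : 2 * l ≤ 1 := by rw [hl, ← mul_assoc]; norm_num; exact hp
  have hlt : l ≤ 2⁻¹ := by
    rw [ENNReal.le_inv_iff_mul_le, mul_comm]
    exact hl2
  have hgeom : ∑' a : ℕ, l ^ a ≤ 2 := by
    rw [ENNReal.tsum_geometric, ENNReal.inv_le_iff_inv_le, ENNReal.le_sub_iff_add_le_left]
    · calc l + 2⁻¹ ≤ 2⁻¹ + 2⁻¹ := by gcongr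
        _ = 1 := ENNReal.inv_two_add_inv_two
    · exact ne_top_of_le_ne_top (by simp) hlt
    · exact hlt.trans (by simp)
  let ψ : V → ℝ≥0∞ := fun x => ∑' a, l ^ a * pullCount κ a x
  -- This fixed point equation controls the pull term. The push term is controlled by `l * ψ y ≤ 1`
  -- off `B` together with `1 ≤ ψ x`, and staying active by `l ≤ 1`.
  have hψ : ∀ x, ψ x = 1 + l * ∑ y, κ y {x} * ψ y := by
    intro x
    simp only [ψ]
    rw [tsum_eq_zero_add' ENNReal.summable]
    congr 1
    · simp [pullCount]
    · simp_rw [← ENNReal.tsum_mul_left]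
      rw [← Summable.tsum_finsetSum fun _ _ => ENNReal.summable, ← ENNReal.tsum_mul_left]
      refine tsum_congr fun a => ?_
      rw [pullCount, Finset.mul_sum, Finset.mul_sum]
      refine Finset.sum_congr rfl fun y _ => ?_
      ring
  have hsum : ∑ x, ψ x ≤ 2 * Fintype.card V := by
    simp only [ψ]
    rw [← Summable.tsum_finsetSum fun _ _ => ENNReal.summable]
    simp_rw [← Finset.mul_sum, sum_pullCount]
    rw [ENNReal.tsum_mul_right]
    gcongr
  have hsum' : ∑ x, l * ∑ y, κ y {x} * ψ y ≤ l * (2 * Fintype.card V) := by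
    rw [← Finset.mul_sum, Finset.sum_comm]
    gcongr
    refine le_trans (le_of_eq ?_) hsum
    refine Finset.sum_congr rfl fun y _ => ?_
    rw [← Finset.sum_mul, sum_measure_singleton]
    simp
  refine ⟨ψ, {y | 1 < l * ψ y}, fun x => ?_, fun x => ?_, hsum, ?_⟩
  · rw [hψ]
    exact le_self_add
  · have h1 : 1 ≤ ψ x := by rw [hψ]; exact le_self_add
    have hpush : l * ∑ y, (if y ∈ {y | 1 < l * ψ y} then 0 else κ x {y} * ψ y) ≤ 1 := by
      rw [Finset.mul_sum]
      calc _ ≤ ∑ y, κ x {y} := by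
            refine Finset.sum_le_sum fun y _ => ?_
            split_ifs with h
            · simp
            · rw [mul_left_comm]
              exact mul_le_of_le_one_right' (not_lt.1 h)
        _ = 1 := by rw [sum_measure_singleton]; simp
    have hpull : l * ∑ y, κ y {x} * ψ y ≤ ψ x := by
      conv_rhs => rw [hψ]
      exact le_add_self
    have hstay : l * ψ x ≤ ψ x := by
      exact mul_le_of_le_one_left' (hlt.trans (by simp))
    have h6 : 6 * (p * (ψ x + ∑ y, (if y ∈ {y | 1 < l * ψ y} then 0 else κ x {y} * ψ y) +
        ∑ y, κ y {x} * ψ y)) ≤ 3 * ψ x := by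
      rw [← mul_assoc, ← hl, mul_add, mul_add]
      calc _ ≤ ψ x + ψ x + ψ x := by
            gcongr
            exact hpush.trans h1
        _ = 3 * ψ x := by ring
    have h63 : (3 : ℝ≥0∞) = 6 * 2⁻¹ := by
      rw [show (6 : ℝ≥0∞) = 3 * 2 by norm_num, mul_assoc, ENNReal.mul_inv_cancel (by simp) (by simp),
        mul_one]
    rw [h63, mul_assoc] at h6
    refine (ENNReal.mul_le_mul_iff_right (a := 6) (by simp) (by simp)).1 ?_
    convert! h6
  -- Markov's inequality for `ψ` itself would bound `B` only linearly in `p`. Since `l ≤ 1/2`, the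
  -- summand `1` of `ψ y` cannot account for more than half of `l * ψ y`, and the remainder carries
  -- a second factor `l`.
  · have hB : ∀ y ∈ {y | 1 < l * ψ y}, 1 ≤ 2 * l * (l * ∑ x, κ x {y} * ψ x) := by
      intro y hy
      have hy' : 1 < l * ψ y := hy
      rw [hψ, mul_add, mul_one] at hy'
      have h2 : 2⁻¹ ≤ l * (l * ∑ x, κ x {y} * ψ x) := by
        by_contra! h
        have : l + l * (l * ∑ x, κ x {y} * ψ x) ≤ 2⁻¹ + 2⁻¹ := add_le_add hlt h.le
        rw [ENNReal.inv_two_add_inv_two] at this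
        exact absurd hy' (not_lt.2 this)
      calc (1 : ℝ≥0∞) = 2 * 2⁻¹ := (ENNReal.mul_inv_cancel (by simp) (by simp)).symm
        _ ≤ 2 * (l * (l * ∑ x, κ x {y} * ψ x)) := by gcongr
        _ = _ := by ring
    have hcard : (({y | 1 < l * ψ y} : Set V).ncard : ℝ≥0∞) =
        ∑ y ∈ Finset.univ.filter (fun y => 1 < l * ψ y), 1 := by
      rw [Set.ncard_eq_toFinset_card']
      simp
    rw [hcard]
    calc _ ≤ ∑ y ∈ Finset.univ.filter (fun y => 1 < l * ψ y),
          2 * l * (l * ∑ x, κ x {y} * ψ x) :=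
          Finset.sum_le_sum fun y hy => hB y (Finset.mem_filter.1 hy).2
      _ ≤ ∑ y, 2 * l * (l * ∑ x, κ x {y} * ψ x) :=
          Finset.sum_le_sum_of_subset (Finset.subset_univ _)
      _ = 2 * l * ∑ y, l * ∑ x, κ x {y} * ψ x := by rw [Finset.mul_sum]
      _ ≤ 2 * l * (l * (2 * Fintype.card V)) := by gcongr
      _ = _ := by rw [hl]; ring

end Potential

/-! ### From the asynchronous protocol to windows. -/

section Async

variable {V : Type*}

lemma windows_succ (E : ℕ → V → V → Prop) (k : ℕ) : ∀ (w : ℕ) (S : Set V),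
    windows E (k + 1) w S = {v | Reach (E (w + k)) (windows E k w S) v} := by
  induction k with
  | zero => exact fun w S => rfl
  | succ k ih =>
    intro w S
    rw [windows, ih]
    simp only [windows]
    rw [show w + 1 + k = w + (k + 1) by omega]

lemma windows_le (E : ℕ → V → V → Prop) (S : Set V) {k l : ℕ} (h : k ≤ l) :
    windows E k 0 S ⊆ windows E l 0 S := by
  induction l, h using Nat.le_induction with
  | base => exact subset_rfl
  | succ l _ ih =>
    rw [windows_succ]
    exact fun v hv => .base (ih hv)

lemma AsyncKnows.nonneg {ω : AsyncSample V} {s : V} {t : ℝ} {v : V} (h : AsyncKnows ω s t v) :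
    0 ≤ t := by
  induction h with
  | start => exact le_rfl
  | remember _ h ih => exact ih.trans h
  | push _ h ih => exact ih.trans h.le
  | pull _ h ih => exact ih.trans h.le

/-- The time windows `(j τ, (j + 1) τ]`. -/
def timeWindow (W : ℕ) (τ : ℝ) (j : Fin W) : Set ℝ := Set.Ioc (j * τ) ((j + 1) * τ)

lemma timeWindow_disjoint {W : ℕ} {τ : ℝ} (hτ : 0 < τ) (a : ℝ) (i j : Fin W)
    (hi : a ∈ timeWindow W τ i) (hj : a ∈ timeWindow W τ j) : i = j := by
  have key : ∀ i j : Fin W, a ∈ timeWindow W τ i → a ∈ timeWindow W τ j → (i : ℕ) ≤ j := by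
    intro i j hi hj
    have := hi.1.trans_le hj.2
    have := lt_of_mul_lt_mul_right this hτ.le
    have : (i : ℕ) < j + 1 := by exact_mod_cast this
    omega
  exact Fin.ext (le_antisymm (key i j hi hj) (key j i hj hi))

lemma volume_timeWindow (W : ℕ) (τ : ℝ) (j : Fin W) :
    volume (timeWindow W τ j) = ENNReal.ofReal τ := by
  rw [timeWindow, Real.volume_Ioc]
  congr 1
  ring

/-- The row of the clock of a vertex. -/
def asyncRow (W : ℕ) (τ : ℝ) (ω : AsyncSample V) (x : V) : Row W V :=
  clockRow (timeWindow W τ) 0 fun k => ω (x, k)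

lemma exists_window {τ a : ℝ} (hτ : 0 < τ) (ha : 0 < a) :
    ∃ i : ℕ, i * τ < a ∧ a ≤ (i + 1) * τ := by
  have h0 : 0 < ⌈a / τ⌉₊ := Nat.ceil_pos.2 (div_pos ha hτ)
  refine ⟨⌈a / τ⌉₊ - 1, ?_, ?_⟩
  · rw [← lt_div_iff₀ hτ]
    exact Nat.lt_ceil.1 (by omega)
  · rw [← div_le_iff₀ hτ]
    have : ((⌈a / τ⌉₊ - 1 : ℕ) : ℝ) + 1 = ⌈a / τ⌉₊ := by
      exact_mod_cast Nat.sub_add_cancel h0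
    rw [this]
    exact Nat.le_ceil _

lemma asyncRow_called {W : ℕ} {τ : ℝ} (ω : AsyncSample V) (x : V) (k : ℕ)
    {i : ℕ} (hi : i < W) (h1 : i * τ < ringTime ω x k) (h2 : ringTime ω x k ≤ (i + 1) * τ) :
    (asyncRow W τ ω x).called i (callee ω x k) := by
  refine ⟨hi, k, ?_, rfl⟩
  rw [zero_add]
  exact ⟨h1, h2⟩

lemma AsyncKnows.mem_windows {W : ℕ} {τ : ℝ} (hτ : 0 < τ) {ω : AsyncSample V} {s : V} {t : ℝ}
    {v : V} (h : AsyncKnows ω s t v) : ∀ w : ℕ, w ≤ W → t ≤ w * τ →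
      v ∈ windows (fun i x y => (asyncRow W τ ω x).called i y) w 0 {s} := by
  induction h with
  | start => exact fun w _ _ => windows_le _ _ (Nat.zero_le w) rfl
  | remember _ h ih => exact fun w hw ht => ih w hw (h.trans ht)
  | @push t x k hx h ih =>
    intro w hw ht
    obtain ⟨i, h1, h2⟩ := exists_window hτ (hx.nonneg.trans_lt h)
    have hi : i < w := by
      have := lt_of_mul_lt_mul_right (h1.trans_le ht) hτ.le
      exact_mod_cast this
    refine windows_le _ _ (show i + 1 ≤ w from hi) ?_
    have hx' := ih (i + 1) (by omega) (by push_cast; exact h.le.trans h2)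
    rw [windows_succ, zero_add] at hx' ⊢
    exact .push hx' (asyncRow_called ω x k (by omega) h1 h2)
  | @pull t x k hx h ih =>
    intro w hw ht
    obtain ⟨i, h1, h2⟩ := exists_window hτ (hx.nonneg.trans_lt h)
    have hi : i < w := by
      have := lt_of_mul_lt_mul_right (h1.trans_le ht) hτ.le
      exact_mod_cast this
    refine windows_le _ _ (show i + 1 ≤ w from hi) ?_
    have hx' := ih (i + 1) (by omega) (by push_cast; exact h.le.trans h2)
    rw [windows_succ, zero_add] at hx' ⊢
    exact .pull hx' (asyncRow_called ω x k (by omega) h1 h2)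

/-- The spread time is an infimum; the slack `t < t'` avoids having to show that it is attained. -/
lemma asyncKnows_of_spreadTime_le {ω : AsyncSample V} {s : V} {t t' : ℝ} (ht : t < t')
    (ht0 : 0 ≤ t) (h : asyncSpreadTime ω s ≤ ENNReal.ofReal t) (v : V) : AsyncKnows ω s t' v := by
  have h1 : asyncSpreadTime ω s < ENNReal.ofReal t' :=
    h.trans_lt ((ENNReal.ofReal_lt_ofReal_iff (ht0.trans_lt ht)).2 ht)
  simp only [asyncSpreadTime, iInf_lt_iff] at h1
  obtain ⟨u, hu, hut⟩ := h1
  refine (hu v).remember ?_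
  rw [← ENNReal.ofReal_coe_nnreal] at hut
  exact ((ENNReal.ofReal_lt_ofReal_iff (ht0.trans_lt ht)).1 hut).le

variable [Fintype V] [MeasurableSpace V] [DiscreteMeasurableSpace V] (G : SimpleGraph V)

/-- The law of the row of the clock of `x`. -/
noncomputable def rowLaw (W : ℕ) (τ : ℝ) (x : V) : Measure (Row W V) :=
  (Measure.infinitePi fun _ : ℕ => (expMeasure 1).prod (callPMF G x).toMeasure).map
    (clockRow (timeWindow W τ) 0)

lemma measurable_clockRow_timeWindow (W : ℕ) (τ : ℝ) :
    Measurable (clockRow (V := V) (timeWindow W τ) 0) :=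
  (measurable_clockRow fun _ => measurableSet_Ioc).comp (measurable_const.prodMk measurable_id)

instance (W : ℕ) (τ : ℝ) (x : V) : IsProbabilityMeasure (rowLaw G W τ x) :=
  Measure.isProbabilityMeasure_map (measurable_clockRow_timeWindow W τ).aemeasurable

lemma meckeLaw_rowLaw {W : ℕ} {τ : ℝ} (hτ : 0 < τ) (x : V) :
    MeckeLaw (ENNReal.ofReal τ) (callPMF G x).toMeasure (rowLaw G W τ x) := by
  intro w y h
  have hm : ∀ f : Row W V → ℝ≥0∞, Measurable f := fun f => measurable_of_countable f
  rw [rowLaw, lintegral_map (hm _) (measurable_clockRow_timeWindow W τ),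
    lintegral_map (hm fun r => h (r ⊔ Row.single W w y)) (measurable_clockRow_timeWindow W τ)]
  by_cases hw : w < W
  · have := lintegral_clockRow_le (callPMF G x).toMeasure (B := timeWindow W τ)
      (fun _ => measurableSet_Ioc) (timeWindow_disjoint hτ) ⟨w, hw⟩ y h
    rw [volume_timeWindow] at this
    convert this using 4
    · ext r
      simp [Row.called, hw]
    · congr 2
      funext i z
      simp [Row.single, Fin.ext_iff]
  · have : {r : Row W V | r.called w y} = ∅ := by
      ext r
      simp [Row.called, hw]
    simp [this]

lemma map_asyncRow (W : ℕ) (τ : ℝ) :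
    (asyncMeasure G).map (asyncRow W τ) = Measure.pi (rowLaw G W τ) := by
  have h1 := Measure.infinitePi_map_curry
    (fun (x : V) (_ : ℕ) => (expMeasure 1).prod (callPMF G x).toMeasure)
  have h2 := Measure.pi_map_pi (μ := fun x : V => Measure.infinitePi fun _ : ℕ =>
    (expMeasure 1).prod (callPMF G x).toMeasure) (f := fun _ => clockRow (timeWindow W τ) 0)
    (hμ := fun x => inferInstanceAs (SigmaFinite (rowLaw G W τ x)))
    fun x => (measurable_clockRow_timeWindow W τ).aemeasurable
  rw [← Measure.infinitePi_eq_pi, ← h1, Measure.map_map ?_ (MeasurableEquiv.measurable _)] at h2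
  · exact h2
  · exact measurable_pi_iff.2 fun x =>
      (measurable_clockRow_timeWindow W τ).comp (measurable_pi_apply x)

lemma measure_asyncKnows_le {W : ℕ} {τ : ℝ} (hτ : 0 < τ) (s : V) :
    asyncMeasure G {ω | ∀ v, AsyncKnows ω s (W * τ) v} ≤ Measure.pi (rowLaw G W τ)
      {R | windows (fun i x y => (R x).called i y) W 0 {s} = Set.univ} := by
  have hm : Measurable (asyncRow (V := V) W τ) := by
    refine measurable_pi_iff.2 fun x => (measurable_clockRow_timeWindow W τ).comp ?_
    fun_prop
  rw [← map_asyncRow, Measure.map_apply hm (Set.to_countable _).measurableSet]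
  refine measure_mono fun ω hω => ?_
  exact Set.eq_univ_of_forall fun v => (hω v).mem_windows hτ W le_rfl le_rfl

end Async

/-! ### The synchronous protocol as the calls of the levels. -/

section Sync

variable {V : Type*}

lemma not_forall_mem_of_lt_syncSpreadTime {c : SyncCalls V} {s : V} {a : ℝ} {r : ℕ} (hr : (r : ℝ) ≤ a)
    (h : ENNReal.ofReal a < syncSpreadTime c s) : ¬ ∀ v, v ∈ syncInformed c s r := by
  intro hv
  refine absurd h (not_lt.2 ?_)
  refine (iInf₂_le r hv).trans ?_
  rw [← ENNReal.ofReal_natCast]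
  exact ENNReal.ofReal_le_ofReal hr

variable [Fintype V] [MeasurableSpace V] [DiscreteMeasurableSpace V] (G : SimpleGraph V)

lemma measurableSet_syncInformed (s : V) (r : ℕ) :
    ∀ v, MeasurableSet {c : SyncCalls V | v ∈ syncInformed c s r} := by
  induction r with
  | zero => exact fun v => MeasurableSet.const _
  | succ r ih =>
    intro v
    have : {c : SyncCalls V | v ∈ syncInformed c s (r + 1)} =
        {c | v ∈ syncInformed c s r} ∪
          ((⋃ x, {c | x ∈ syncInformed c s r} ∩ (fun c : SyncCalls V => c (r, x)) ⁻¹' {v}) ∪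
            ⋃ y, (fun c : SyncCalls V => c (r, v)) ⁻¹' {y} ∩ {c | y ∈ syncInformed c s r}) := by
      ext c
      simp [syncInformed]
    rw [this]
    refine (ih v).union (MeasurableSet.union ?_ ?_)
    · exact MeasurableSet.iUnion fun x => (ih x).inter
        (measurable_pi_apply _ (measurableSet_singleton v))
    · exact MeasurableSet.iUnion fun y => MeasurableSet.inter
        (measurable_pi_apply _ (measurableSet_singleton y)) (ih y)

lemma map_levelLaw {V : Type*} [Fintype V] [MeasurableSpace V] (G : SimpleGraph V) {p : ℝ≥0∞} (hp : p ≤ 1) :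
    (Measure.infinitePi fun _ : ℕ => State.levelLaw p fun x => (callPMF G x).toMeasure).map
      (fun θ q => (θ q.1 q.2).1) = syncMeasure G := by
  have := isProbabilityMeasure_coin hp
  have := State.isProbabilityMeasure_levelLaw (fun x => (callPMF G x).toMeasure) hp
  have h1 : (State.levelLaw p fun x => (callPMF G x).toMeasure).map (fun z x => (z x).1) =
      Measure.infinitePi fun x => (callPMF G x).toMeasure := by
    have hf : ∀ x, (((callPMF G x).toMeasure).prod (coin p)).map Prod.fst =
        (callPMF G x).toMeasure := fun x => by
      rw [Measure.map_fst_prod, measure_univ, one_smul]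
    rw [State.levelLaw, Measure.pi_map_pi (f := fun _ => Prod.fst)
      (hμ := fun x => by rw [hf]; infer_instance) fun x => measurable_fst.aemeasurable,
      Measure.infinitePi_eq_pi]
    simp_rw [hf]
  have h2 := Measure.infinitePi_map_pi
    (fun _ : ℕ => State.levelLaw p fun x => (callPMF G x).toMeasure)
    (f := fun _ (z : V → V × Bool) x => (z x).1) fun _ => by fun_prop
  simp_rw [h1] at h2
  have h3 := Measure.infinitePi_map_curry_symm
    (fun (_ : ℕ) (x : V) => (callPMF G x).toMeasure)
  rw [← h2, Measure.map_map (MeasurableEquiv.measurable _) (by fun_prop)] at h3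
  exact h3

end Sync

section Probability

variable {V : Type*} [Fintype V] [MeasurableSpace V] (G : SimpleGraph V)

instance : IsProbabilityMeasure (syncMeasure G) := by
  unfold syncMeasure
  infer_instance

instance : IsProbabilityMeasure (asyncMeasure G) := by
  unfold asyncMeasure
  infer_instance

end Probability

/-! ### Synchronous spread in `O(n log n)` rounds on connected graphs. -/

section Connected

variable {V : Type*} [Fintype V] (G : SimpleGraph V)

open Classical in
/-- If every vertex calls each of its neighbours often enough, then the rumour travels along
shortest paths. -/
lemma mem_syncInformed_of_calls (hG : G.Connected) (c : SyncCalls V) (s : V) (a : ℕ)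
    (hc : ∀ x y, G.Adj x y → ∀ r ≤ 3 * Fintype.card V * a,
      ∃ j < a * (Finset.univ.filter (G.Adj x)).card, c (r + j, x) = y) (v : V) :
    v ∈ syncInformed c s (3 * Fintype.card V * a) := by
  have hmono : Monotone (syncInformed c s) :=
    monotone_nat_of_le_succ fun r v hv => Or.inl hv
  -- `∑ u, m i u` bounds the sum of the degrees of the vertices at distances `0, …, i - 1` from `s`
  -- along a shortest path: a neighbour `u` of the vertex at distance `j` has distance within `1` of
  -- `j`. Each `u` is counted at most three times, whence `3 n`.
  let m : ℕ → V → ℕ := fun i u =>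
    ((Finset.range i).filter fun j => j ≤ G.dist u s + 1 ∧ G.dist u s ≤ j + 1).card
  have hm3 : ∀ i, ∑ u, m i u ≤ 3 * Fintype.card V := by
    intro i
    calc ∑ u, m i u ≤ ∑ _u : V, 3 := by
          refine Finset.sum_le_sum fun u _ => ?_
          refine (Finset.card_le_card (t := Finset.Icc (G.dist u s - 1) (G.dist u s + 1)) ?_).trans
            ?_
          · intro j hj
            have := (Finset.mem_filter.1 hj).2
            rw [Finset.mem_Icc]
            omega
          · rw [Nat.card_Icc]
            omega
      _ = _ := by simp [mul_comm]
  have key : ∀ i v, G.dist v s = i → ∃ b ≤ ∑ u, m i u, v ∈ syncInformed c s (b * a) := by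
    intro i
    induction i with
    | zero =>
      intro v hv
      have : v = s := by
        rcases SimpleGraph.dist_eq_zero_iff_eq_or_not_reachable.1 hv with h | h
        · exact h
        · exact absurd (hG.preconnected v s) h
      exact ⟨0, Nat.zero_le _, by rw [zero_mul, this]; exact rfl⟩
    | succ i ih =>
      intro v hv
      obtain ⟨w, hw⟩ := hG.exists_walk_length_eq_dist v s
      cases w with
      | nil => simp at hv
      | @cons _ x _ hadj q =>
        have h1 : G.dist x s ≤ q.length := SimpleGraph.dist_le q
        have h2 : G.dist v s ≤ G.dist v x + G.dist x s := hG.dist_triangle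
        rw [SimpleGraph.dist_eq_one_iff_adj.2 hadj] at h2
        rw [SimpleGraph.Walk.length_cons] at hw
        obtain ⟨b, hb, hx⟩ := ih x (by omega)
        have hdx : G.dist x s = i := by omega
        have hdeg : (Finset.univ.filter (G.Adj x)).card + ∑ u, m i u ≤ ∑ u, m (i + 1) u := by
          rw [Finset.card_filter, ← Finset.sum_add_distrib]
          refine Finset.sum_le_sum fun u _ => ?_
          simp only [m, Finset.range_add_one, Finset.filter_insert]
          by_cases hu : G.Adj x u
          · have t1 : G.dist x s ≤ G.dist x u + G.dist u s := hG.dist_triangle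
            have t2 : G.dist u s ≤ G.dist u x + G.dist x s := hG.dist_triangle
            rw [SimpleGraph.dist_eq_one_iff_adj.2 hu] at t1
            rw [SimpleGraph.dist_eq_one_iff_adj.2 hu.symm] at t2
            rw [if_pos hu, if_pos ⟨by omega, by omega⟩, Finset.card_insert_of_notMem (by simp)]
            omega
          · rw [if_neg hu, zero_add]
            split_ifs
            · exact Finset.card_le_card (Finset.subset_insert _ _)
            · exact le_rfl
        obtain ⟨j, hj, hcj⟩ := hc x v hadj.symm (b * a)
          (Nat.mul_le_mul_right _ (hb.trans (hm3 i)))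
        refine ⟨b + (Finset.univ.filter (G.Adj x)).card, by omega, ?_⟩
        refine hmono (show b * a + j + 1 ≤ _ by rw [add_mul, mul_comm _ a, mul_comm _ a]; omega) ?_
        exact Or.inr (Or.inl ⟨x, hmono (Nat.le_add_right _ _) hx, hcj⟩)
  obtain ⟨b, hb, hv⟩ := key _ v rfl
  exact hmono (Nat.mul_le_mul_right _ (hb.trans (hm3 _))) hv

variable [MeasurableSpace V] [DiscreteMeasurableSpace V]

-- With `d` the degree of `x`, the probability is `(1 - 1/d)^(a d)`, which is at most `exp (-a)`.
open Classical in
lemma measure_no_call_le {x y : V} (h : G.Adj x y) (r a : ℕ) :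
    syncMeasure G {c | ∀ j < a * (Finset.univ.filter (G.Adj x)).card, c (r + j, x) ≠ y} ≤
      ENNReal.ofReal (Real.exp (-a)) := by
  set d := (Finset.univ.filter (G.Adj x)).card with hd
  have hy : y ∈ Finset.univ.filter (G.Adj x) := by simp [h]
  have hne : (Finset.univ.filter (G.Adj x)).Nonempty := ⟨y, hy⟩
  have hd0 : 0 < d := Finset.card_pos.2 hne
  have hcall : callPMF G x y = (d : ℝ≥0∞)⁻¹ := by
    rw [callPMF, dif_pos (by convert hne)]
    rw [PMF.uniformOfFinset_apply_of_mem]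
    simpa using h
  have hset : {c : SyncCalls V | ∀ j < a * d, c (r + j, x) ≠ y} =
      Set.pi ((Finset.range (a * d)).image fun j => (r + j, x) : Finset (ℕ × V))
        (fun _ => {y}ᶜ) := by
    ext c
    simp [Set.mem_pi]
  rw [hset, syncMeasure, Measure.infinitePi_pi _ (fun _ _ => (measurableSet_singleton y).compl),
    Finset.prod_image (fun i _ j _ hij => by
      have : r + i = r + j := (Prod.mk.inj (show (r + i, x) = (r + j, x) from hij)).1
      omega)]
  simp only [Finset.prod_const, Finset.card_range]
  rw [prob_compl_eq_one_sub (measurableSet_singleton y),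
    PMF.toMeasure_apply_singleton _ _ (measurableSet_singleton y), hcall]
  have hd1 : (1 : ℝ) ≤ d := by exact_mod_cast hd0
  have h1 : (1 : ℝ≥0∞) - (d : ℝ≥0∞)⁻¹ = ENNReal.ofReal (1 - (d : ℝ)⁻¹) := by
    rw [ENNReal.ofReal_sub _ (by positivity), ENNReal.ofReal_one,
      ENNReal.ofReal_inv_of_pos (by linarith), ENNReal.ofReal_natCast]
  have h0 : 0 ≤ 1 - (d : ℝ)⁻¹ := by
    have := inv_le_one_of_one_le₀ hd1
    linarith
  rw [h1, ← ENNReal.ofReal_pow h0]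
  refine ENNReal.ofReal_le_ofReal ?_
  calc (1 - (d : ℝ)⁻¹) ^ (a * d) ≤ (Real.exp (-(d : ℝ)⁻¹)) ^ (a * d) := by
        gcongr
        have := Real.add_one_le_exp (-(d : ℝ)⁻¹)
        linarith
    _ = Real.exp (-a) := by
        rw [← Real.exp_nat_mul]
        congr 1
        push_cast
        field_simp

lemma measure_not_syncInformed_le (hG : G.Connected) (s : V) (a : ℕ) :
    syncMeasure G {c | ¬ ∀ v, v ∈ syncInformed c s (3 * Fintype.card V * a)} ≤
      (Fintype.card V * (Fintype.card V * (3 * Fintype.card V * a + 1)) : ℕ) *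
        ENNReal.ofReal (Real.exp (-a)) := by
  classical
  have hsub : {c | ¬ ∀ v, v ∈ syncInformed c s (3 * Fintype.card V * a)} ⊆
      ⋃ x : V, ⋃ y : V, ⋃ r ∈ Finset.range (3 * Fintype.card V * a + 1),
        {c : SyncCalls V | G.Adj x y ∧
          ∀ j < a * (Finset.univ.filter (G.Adj x)).card, c (r + j, x) ≠ y} := by
    intro c hc
    by_contra h
    refine hc (mem_syncInformed_of_calls G hG c s a fun x y hxy r hr => ?_)
    by_contra! hj
    refine h ?_
    simp only [Set.mem_iUnion]
    exact ⟨x, y, r, Finset.mem_range.2 (by omega), hxy, hj⟩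
  refine (measure_mono hsub).trans ((measure_iUnion_fintype_le _ _).trans ?_)
  calc _ ≤ ∑ _x : V, ∑ _y : V, ∑ _r ∈ Finset.range (3 * Fintype.card V * a + 1),
        ENNReal.ofReal (Real.exp (-a)) := by
        refine Finset.sum_le_sum fun x _ => (measure_iUnion_fintype_le _ _).trans ?_
        refine Finset.sum_le_sum fun y _ => (measure_biUnion_finset_le _ _).trans ?_
        refine Finset.sum_le_sum fun r _ => ?_
        by_cases hxy : G.Adj x y
        · simp only [hxy, true_and]
          exact measure_no_call_le G hxy r a
        · simp [hxy]
    _ = _ := by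
        simp only [Finset.sum_const, Finset.card_univ, Finset.card_range, nsmul_eq_mul]
        push_cast
        ring

end Connected

/-! ### Disconnected graphs. -/

section Disconnected

lemma AsyncKnows.reachable {V : Type*} {G : SimpleGraph V} {ω : AsyncSample V}
    (hω : ∀ x k, callee ω x k = x ∨ G.Adj x (callee ω x k)) {s : V} {t : ℝ} {v : V}
    (h : AsyncKnows ω s t v) : G.Reachable s v := by
  induction h with
  | start => exact .rfl
  | remember _ _ ih => exact ih
  | @push t x k _ _ ih =>
    rcases hω x k with h | h
    · rwa [h]
    · exact ih.trans h.reachable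
  | @pull t x k _ _ ih =>
    rcases hω x k with h | h
    · rwa [h] at ih
    · exact ih.trans h.symm.reachable

variable {V : Type*} [Fintype V] [MeasurableSpace V] [DiscreteMeasurableSpace V]
  (G : SimpleGraph V)

lemma ae_callee : ∀ᵐ ω ∂asyncMeasure G, ∀ x k, callee ω x k = x ∨ G.Adj x (callee ω x k) := by
  refine ae_all_iff.2 fun x => ae_all_iff.2 fun k => ?_
  have h1 : ∀ᵐ y ∂(callPMF G x).toMeasure, y = x ∨ G.Adj x y := by
    rw [ae_iff, PMF.toMeasure_apply_eq_zero_iff _ (Set.to_countable _).measurableSet]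
    rw [Set.disjoint_left]
    intro y hy
    simp only [Set.mem_ofPred_eq, not_not]
    unfold callPMF at hy
    split_ifs at hy with h
    · right
      rw [PMF.mem_support_uniformOfFinset_iff] at hy
      simpa using hy
    · left
      simpa using hy
  have h2 : ∀ᵐ q ∂((expMeasure 1).prod (callPMF G x).toMeasure), q.2 = x ∨ G.Adj x q.2 :=
    Measure.quasiMeasurePreserving_snd.ae h1
  exact (measurePreserving_eval_infinitePi
    (fun q : V × ℕ => (expMeasure 1).prod (callPMF G q.1).toMeasure)
      (x, k)).quasiMeasurePreserving.ae h2

lemma measure_asyncSpreadTime_of_not_connected (hG : ¬ G.Connected) (s : V) (t : ℝ) :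
    asyncMeasure G {ω | ENNReal.ofReal t < asyncSpreadTime ω s} = 1 := by
  obtain ⟨v, hv⟩ : ∃ v, ¬ G.Reachable s v := by
    by_contra! h
    have : Nonempty V := ⟨s⟩
    exact hG ⟨fun u v => (h u).symm.trans (h v)⟩
  refine (measure_congr ?_).trans (measure_univ (μ := asyncMeasure G))
  refine Filter.eventuallyEq_univ.2 ?_
  filter_upwards [ae_callee G] with ω hω
  have htop : asyncSpreadTime ω s = ⊤ := by
    simp only [asyncSpreadTime, iInf_eq_top]
    exact fun u hu => absurd ((hu v).reachable hω) hv
  change _ < _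
  rw [htop]
  exact ENNReal.ofReal_lt_top

end Disconnected

/-! ### Choice of parameters and conclusion. -/

section Main

variable {V : Type*} [Fintype V] [MeasurableSpace V] [DiscreteMeasurableSpace V]
  (G : SimpleGraph V)

lemma measure_not_syncInformed_le_async (s : V) {W : ℕ} {τ t : ℝ} (hτ : 0 < τ)
    (hτ' : 12 * τ ≤ 1) (ht : 0 ≤ t) (htW : t < W * τ) {m : ℕ}
    (hm : W + 144 * τ ^ 2 * Fintype.card V < m) (L : ℕ) :
    syncMeasure G {c | ¬ ∀ v, v ∈ syncInformed c s (m * (L + 1))} ≤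
      asyncMeasure G {ω | ENNReal.ofReal t < asyncSpreadTime ω s} +
        m * (2⁻¹ ^ L * (2 * Fintype.card V)) := by
  have hp12 : 12 * ENNReal.ofReal τ ≤ 1 := by
    rw [show (12 : ℝ≥0∞) = ENNReal.ofReal 12 by simp, ← ENNReal.ofReal_mul (by norm_num)]
    exact ENNReal.ofReal_le_one.2 hτ'
  have hp : ENNReal.ofReal τ ≤ 1 := ENNReal.ofReal_le_one.2 (by linarith)
  obtain ⟨ψ, B, h1, hψ, hsum, hB⟩ := exists_contracts (fun x => (callPMF G x).toMeasure) hp12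
  have hB' : (B.ncard : ℝ) ≤ 144 * τ ^ 2 * Fintype.card V := by
    have e : (144 * ENNReal.ofReal τ ^ 2 * Fintype.card V : ℝ≥0∞) =
        ENNReal.ofReal (144 * τ ^ 2 * Fintype.card V) := by
      rw [ENNReal.ofReal_mul (by positivity), ENNReal.ofReal_mul (by norm_num),
        ENNReal.ofReal_pow hτ.le, ENNReal.ofReal_natCast]
      simp
    rw [e, ← ENNReal.ofReal_natCast, ENNReal.ofReal_le_ofReal_iff (by positivity)] at hB
    exact hB
  have hmB : W + B.ncard < m := by
    have : (W + B.ncard : ℝ) < m := by linarith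
    exact_mod_cast this
  have hmeas : MeasurableSet {c : SyncCalls V | ∀ v, v ∈ syncInformed c s (m * (L + 1))} := by
    have : {c : SyncCalls V | ∀ v, v ∈ syncInformed c s (m * (L + 1))} =
        ⋂ v, {c | v ∈ syncInformed c s (m * (L + 1))} := by
      ext c; simp
    rw [this]
    exact MeasurableSet.iInter fun v => measurableSet_syncInformed s _ v
  have hmain := State.measure_windows_le (fun x => (callPMF G x).toMeasure) hp (rowLaw G W τ)
    (fun x => meckeLaw_rowLaw G hτ x) h1 hψ L m W hmB s
  have hsync : Measure.infinitePi (fun _ : ℕ => State.levelLaw (ENNReal.ofReal τ)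
      fun x => (callPMF G x).toMeasure)
        {θ | ∀ v, v ∈ syncInformed (fun q => (θ q.1 q.2).1) s (m * (L + 1))} =
      syncMeasure G {c | ∀ v, v ∈ syncInformed c s (m * (L + 1))} := by
    rw [← map_levelLaw G hp, Measure.map_apply (by fun_prop) hmeas]
    rfl
  rw [hsync] at hmain
  set S := syncMeasure G {c | ∀ v, v ∈ syncInformed c s (m * (L + 1))} with hS
  set err : ℝ≥0∞ := m * (2⁻¹ ^ L * (2 * Fintype.card V)) with herr
  have hcompl : syncMeasure G {c | ¬ ∀ v, v ∈ syncInformed c s (m * (L + 1))} = 1 - S :=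
    prob_compl_eq_one_sub hmeas
  rw [hcompl]
  refine tsub_le_iff_left.2 ?_
  -- Covering the space by two events needs only subadditivity, so measurability of the asynchronous
  -- events plays no role.
  calc (1 : ℝ≥0∞) = asyncMeasure G Set.univ := measure_univ.symm
    _ ≤ asyncMeasure G ({ω | ENNReal.ofReal t < asyncSpreadTime ω s} ∪
          {ω | ∀ v, AsyncKnows ω s (W * τ) v}) := by
        refine measure_mono fun ω _ => ?_
        by_cases h : ENNReal.ofReal t < asyncSpreadTime ω s
        · exact Or.inl h
        · exact Or.inr (asyncKnows_of_spreadTime_le htW ht (not_lt.1 h))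
    _ ≤ asyncMeasure G {ω | ENNReal.ofReal t < asyncSpreadTime ω s} +
          asyncMeasure G {ω | ∀ v, AsyncKnows ω s (W * τ) v} := measure_union_le _ _
    _ ≤ asyncMeasure G {ω | ENNReal.ofReal t < asyncSpreadTime ω s} + (S + err) := by
        gcongr
        refine (measure_asyncKnows_le G hτ s).trans (hmain.trans ?_)
        rw [herr]
        gcongr
    _ = _ := by ring

end Main

lemma two_mul_log_ge_one {n : ℕ} (hn : 2 ≤ n) : 1 ≤ 2 * Real.log n := by
  have h1 : Real.log 2 ≤ Real.log n := Real.log_le_log (by norm_num) (by exact_mod_cast hn)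
  have := Real.log_two_gt_d9
  linarith

lemma exp_neg_mul_log_le {n : ℕ} (hn : 2 ≤ n) {a b : ℝ} (h : b * Real.log n ≤ a) :
    Real.exp (-a) ≤ (n : ℝ) ^ (-b) := by
  have hn0 : (0 : ℝ) < n := by positivity
  rw [Real.rpow_def_of_pos hn0]
  refine Real.exp_le_exp.2 ?_
  linarith

lemma natCast_pow_mul_rpow_neg {n : ℕ} (hn : 2 ≤ n) (K : ℝ) (j : ℕ) :
    (n : ℝ) ^ j * (n : ℝ) ^ (-(K + j)) = (n : ℝ) ^ (-K) := by
  have hn0 : (0 : ℝ) < n := by positivity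
  rw [← Real.rpow_natCast, ← Real.rpow_add hn0]
  congr 1
  ring

section

variable {V : Type*} [Fintype V] [MeasurableSpace V] [DiscreteMeasurableSpace V]
  (G : SimpleGraph V)

lemma syncMeasure_real_le {V : Type*} [Fintype V] [MeasurableSpace V] (G : SimpleGraph V) {s : V} {a q : ℝ} {r : ℕ} (hr : (r : ℝ) ≤ a) (hq : 0 ≤ q)
    (h : syncMeasure G {c | ¬ ∀ v, v ∈ syncInformed c s r} ≤ ENNReal.ofReal q) :
    (syncMeasure G).real {c | ENNReal.ofReal a < syncSpreadTime c s} ≤ q := by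
  refine ENNReal.toReal_le_of_le_ofReal hq (le_trans (measure_mono ?_) h)
  exact fun c hc => not_forall_mem_of_lt_syncSpreadTime hr hc

lemma sync_le_async_of_le {K : ℝ} (hK : 0 < K) (s : V) {t X : ℝ} (ht : 1 ≤ t)
    (hn : 2 ≤ Fintype.card V) (hX1 : t ≤ X) (hXn : X ≤ Fintype.card V)
    (hX3 : X ^ 3 = t ^ 2 * Fintype.card V) {a : ℝ}
    (ha : 56 * (K + 4) * (X * Real.log (Fintype.card V)) ≤ a) :
    (syncMeasure G).real {c | ENNReal.ofReal a < syncSpreadTime c s} ≤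
      (asyncMeasure G).real {ω | ENNReal.ofReal t < asyncSpreadTime ω s} +
        56 * (Fintype.card V : ℝ) ^ (-K) := by
  set n := Fintype.card V with hnV
  have hlog := two_mul_log_ge_one hn
  have hX : 0 < X := by linarith
  -- With `τ = 2 t / W` the windows end at `2 t > t`. The factor `24` gives `τ ≤ t / (12 X)`, hence
  -- `12 τ ≤ 1` by `t ≤ X`, and `144 τ² n ≤ t² n / X² = X`.
  set W := ⌈24 * X⌉₊ with hW
  have hW1 : 24 * X ≤ W := Nat.le_ceil _
  have hW2 : (W : ℝ) < 24 * X + 1 := Nat.ceil_lt_add_one (by positivity)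
  have hW0 : (0 : ℝ) < W := by linarith
  set τ := 2 * t / W with hτdef
  have hτ : 0 < τ := by positivity
  have hWτ : W * τ = 2 * t := by rw [hτdef]; field_simp
  have hτ' : 12 * τ ≤ 1 := by
    rw [hτdef, ← mul_div_assoc, div_le_one hW0]
    linarith
  have hbig : 144 * τ ^ 2 * n ≤ X := by
    have h1 : τ ≤ t / (12 * X) := by
      rw [hτdef, div_le_div_iff₀ hW0 (by positivity)]
      nlinarith
    calc 144 * τ ^ 2 * n ≤ 144 * (t / (12 * X)) ^ 2 * n := by gcongr
      _ = t ^ 2 * n / X ^ 2 := by field_simp; ring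
      _ = X := by rw [← hX3]; field_simp
  set m := ⌈W + 144 * τ ^ 2 * (n : ℝ)⌉₊ + 1 with hm
  have hm1 : W + 144 * τ ^ 2 * (n : ℝ) < m := by
    rw [hm]
    push_cast
    linarith [Nat.le_ceil (W + 144 * τ ^ 2 * (n : ℝ))]
  have hm2 : (m : ℝ) ≤ 28 * X := by
    have := Nat.ceil_lt_add_one (a := W + 144 * τ ^ 2 * (n : ℝ)) (by positivity)
    rw [hm]
    push_cast
    linarith
  -- This makes `2⁻¹ ^ L` at most `n ^ (-(K + 2))`. The two extra powers of `n` absorb `m ≤ 28 n`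
  -- and the total weight `2 n`.
  set L := ⌈(K + 2) * Real.log n / Real.log 2⌉₊ with hL
  have hl2 : (1 : ℝ) / 2 < Real.log 2 := by linarith [Real.log_two_gt_d9]
  have hL1 : (K + 2) * Real.log n ≤ L * Real.log 2 := by
    rw [← div_le_iff₀ (by linarith)]
    exact Nat.le_ceil _
  have hL2 : (L : ℝ) + 1 ≤ 2 * (K + 4) * Real.log n := by
    have h1 := Nat.ceil_lt_add_one (a := (K + 2) * Real.log n / Real.log 2)
      (div_nonneg (mul_nonneg (by linarith) (by linarith)) (by linarith))
    have h2 : (K + 2) * Real.log n / Real.log 2 ≤ 2 * (K + 2) * Real.log n := by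
      rw [div_le_iff₀ (by linarith)]
      have : 0 ≤ (K + 2) * Real.log n := mul_nonneg (by linarith) (by linarith)
      nlinarith
    nlinarith
  have hpow : (2⁻¹ : ℝ) ^ L ≤ (n : ℝ) ^ (-(K + 2)) := by
    refine le_trans (le_of_eq ?_) (exp_neg_mul_log_le hn hL1)
    rw [Real.exp_neg, Real.exp_nat_mul, Real.exp_log (by norm_num), inv_pow]
  have hmain := measure_not_syncInformed_le_async G s hτ hτ' (t := t) (by linarith)
    (by rw [hWτ]; linarith) hm1 L
  have herr : (m : ℝ) * (2⁻¹ ^ L * (2 * n)) ≤ 56 * (n : ℝ) ^ (-K) := by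
    calc (m : ℝ) * (2⁻¹ ^ L * (2 * n)) ≤ (28 * n) * ((n : ℝ) ^ (-(K + 2)) * (2 * n)) := by
          gcongr
          linarith
      _ = 56 * ((n : ℝ) ^ 2 * (n : ℝ) ^ (-(K + (2 : ℕ)))) := by push_cast; ring
      _ = _ := by rw [natCast_pow_mul_rpow_neg hn]
  have herr' : (m * (2⁻¹ ^ L * (2 * n)) : ℝ≥0∞) ≤ ENNReal.ofReal (56 * (n : ℝ) ^ (-K)) := by
    refine le_trans (le_of_eq ?_) (ENNReal.ofReal_le_ofReal herr)
    rw [ENNReal.ofReal_mul (by positivity), ENNReal.ofReal_mul (by positivity),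
      ENNReal.ofReal_mul (by norm_num), ENNReal.ofReal_pow (by norm_num),
      ENNReal.ofReal_inv_of_pos (by norm_num), ENNReal.ofReal_natCast, ENNReal.ofReal_natCast]
    simp
  refine syncMeasure_real_le G (r := m * (L + 1)) ?_ (by positivity) ?_
  · refine le_trans ?_ ha
    push_cast
    calc (m : ℝ) * (L + 1) ≤ (28 * X) * (2 * (K + 4) * Real.log n) := by gcongr
      _ = _ := by ring
  · refine hmain.trans ?_
    rw [ENNReal.ofReal_add measureReal_nonneg (by positivity), ofReal_measureReal]
    gcongr

lemma sync_le_of_connected {K : ℝ} (hK : 0 < K) (hG : G.Connected) (s : V)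
    (hn : 2 ≤ Fintype.card V) {a : ℝ}
    (ha : 3 * (K + 7) * (Fintype.card V * Real.log (Fintype.card V)) ≤ a) :
    (syncMeasure G).real {c | ENNReal.ofReal a < syncSpreadTime c s} ≤
      4 * (K + 7) * (Fintype.card V : ℝ) ^ (-K) := by
  set n := Fintype.card V with hnV
  have hn2 : (2 : ℝ) ≤ n := by exact_mod_cast hn
  have hlog := two_mul_log_ge_one hn
  -- The union bound has `O(n ^ 4)` terms, so `K + 5` leaves a power of `n` to spare.
  set l := ⌈(K + 5) * Real.log n⌉₊ with hl
  have hl1 : (K + 5) * Real.log n ≤ l := Nat.le_ceil _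
  have hl2 : (l : ℝ) ≤ (K + 7) * Real.log n := by
    have := Nat.ceil_lt_add_one (a := (K + 5) * Real.log n) (mul_nonneg (by linarith) (by linarith))
    nlinarith
  have hlogn : Real.log n ≤ n := (Real.log_le_sub_one_of_pos (by linarith)).trans (by linarith)
  have hln : (l : ℝ) ≤ (K + 7) * n := hl2.trans (by gcongr)
  refine syncMeasure_real_le G (r := 3 * n * l) ?_ (by positivity) ?_
  · refine le_trans ?_ ha
    push_cast
    calc (3 : ℝ) * n * l ≤ 3 * n * ((K + 7) * Real.log n) := by gcongr
      _ = _ := by ring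
  · refine (measure_not_syncInformed_le G hG s l).trans ?_
    rw [← ENNReal.ofReal_natCast, ← ENNReal.ofReal_mul (by positivity)]
    refine ENNReal.ofReal_le_ofReal ?_
    push_cast
    calc (n : ℝ) * (n * (3 * n * l + 1)) * Real.exp (-l)
        ≤ n * (n * (4 * (K + 7) * n ^ 2)) * (n : ℝ) ^ (-(K + 5)) := by
          gcongr
          · have h1 : (3 : ℝ) * n * l ≤ 3 * n * ((K + 7) * n) := by gcongr
            have h2 : 1 ≤ (K + 7) * (n : ℝ) ^ 2 := by nlinarith
            linarith
          · exact exp_neg_mul_log_le hn hl1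
      _ = 4 * (K + 7) * ((n : ℝ) ^ 4 * (n : ℝ) ^ (-(K + 5))) := by ring
      _ ≤ 4 * (K + 7) * ((n : ℝ) ^ 5 * (n : ℝ) ^ (-(K + (5 : ℕ)))) := by
          push_cast
          gcongr
          · linarith
          · norm_num
      _ = _ := by rw [natCast_pow_mul_rpow_neg hn]

end

end PushPull

theorem theorem1 (K : ℝ) (hK : 0 < K) :
    ∃ C : ℝ, 0 < C ∧
      ∀ (V : Type*) [Fintype V] [MeasurableSpace V] [DiscreteMeasurableSpace V]
        (G : SimpleGraph V) (s : V) (t : ℝ), 1 ≤ t →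
        (PushPull.syncMeasure G).real
            {c | ENNReal.ofReal (C * (t + t ^ (2 / 3 : ℝ) * (Fintype.card V : ℝ) ^ (1 / 3 : ℝ) *
                Real.log (Fintype.card V))) < PushPull.syncSpreadTime c s} ≤
          (PushPull.asyncMeasure G).real
            {ω | ENNReal.ofReal t < PushPull.asyncSpreadTime ω s} +
          C * (Fintype.card V : ℝ) ^ (-K) := by
  refine ⟨56 * (K + 7), by positivity, ?_⟩
  intro V _ _ _ G s t ht
  have : Nonempty V := ⟨s⟩
  have hpos : 0 < Fintype.card V := Fintype.card_pos
  -- For a single vertex the logarithm vanishes, but the error term alone is at least `1`.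
  rcases Nat.lt_or_ge (Fintype.card V) 2 with hn | hn
  · have h1 : Fintype.card V = 1 := by omega
    calc _ ≤ (1 : ℝ) := measureReal_le_one
      _ ≤ 56 * (K + 7) * (Fintype.card V : ℝ) ^ (-K) := by
          rw [h1, Nat.cast_one, Real.one_rpow]
          linarith
      _ ≤ _ := le_add_of_nonneg_left measureReal_nonneg
  by_cases hG : G.Connected
  swap
  · calc _ ≤ (1 : ℝ) := measureReal_le_one
      _ = (PushPull.asyncMeasure G).real {ω | ENNReal.ofReal t < PushPull.asyncSpreadTime ω s} := by
          rw [Measure.real, PushPull.measure_asyncSpreadTime_of_not_connected G hG s t,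
            ENNReal.toReal_one]
      _ ≤ _ := le_add_of_nonneg_right (by positivity)
  have hlog := PushPull.two_mul_log_ge_one hn
  set n := Fintype.card V with hnV
  have hn0 : (0 : ℝ) ≤ n := Nat.cast_nonneg _
  set X := t ^ (2 / 3 : ℝ) * (n : ℝ) ^ (1 / 3 : ℝ) with hX
  have hX0 : 0 ≤ X := by positivity
  have hpow : (0 : ℝ) ≤ (n : ℝ) ^ (-K) := by positivity
  have hsplit : ∀ u : ℝ, 0 ≤ u → u ^ (2 / 3 : ℝ) * u ^ (1 / 3 : ℝ) = u := by
    intro u hu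
    rw [← Real.rpow_add' hu (by norm_num)]
    norm_num
  -- `X` is a weighted geometric mean of `t` and `n`, so it lies between them: `t ≤ X ≤ n` in the
  -- first case, and `n ≤ X` in the second, where `X log n` already covers `n log n`.
  rcases le_total t n with htn | htn
  · have h1 : t ≤ X := by
      calc t = t ^ (2 / 3 : ℝ) * t ^ (1 / 3 : ℝ) := (hsplit t (by linarith)).symm
        _ ≤ X := by
          rw [hX]
          gcongr
    have h2 : X ≤ n := by
      calc X ≤ (n : ℝ) ^ (2 / 3 : ℝ) * (n : ℝ) ^ (1 / 3 : ℝ) := by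
            rw [hX]
            gcongr
        _ = n := hsplit n hn0
    have h3 : X ^ 3 = t ^ 2 * n := by
      rw [hX, mul_pow, ← Real.rpow_natCast, ← Real.rpow_mul (by linarith), ← Real.rpow_natCast,
        ← Real.rpow_mul hn0]
      norm_num
    refine (PushPull.sync_le_async_of_le G hK s ht hn h1 h2 h3 ?_).trans ?_
    · have : 0 ≤ X * Real.log n := mul_nonneg hX0 (by linarith)
      nlinarith
    · gcongr
      linarith
  · have h1 : (n : ℝ) ≤ X := by
      calc (n : ℝ) = (n : ℝ) ^ (2 / 3 : ℝ) * (n : ℝ) ^ (1 / 3 : ℝ) := (hsplit n hn0).symm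
        _ ≤ X := by
          rw [hX]
          gcongr
    refine (PushPull.sync_le_of_connected G hK hG s hn (a := 56 * (K + 7) *
      (t + X * Real.log n)) ?_).trans ?_
    · have h4 : n * Real.log n ≤ X * Real.log n :=
        mul_le_mul_of_nonneg_right h1 (by linarith)
      have h5 : 0 ≤ n * Real.log n := mul_nonneg hn0 (by linarith)
      nlinarith
    · have : 0 ≤ (PushPull.asyncMeasure G).real
          {ω | ENNReal.ofReal t < PushPull.asyncSpreadTime ω s} := measureReal_nonneg
      have : 4 * (K + 7) * (n : ℝ) ^ (-K) ≤ 56 * (K + 7) * (n : ℝ) ^ (-K) := by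
        gcongr
        norm_num
      linarith
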